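/- Let $M\cong\mathbb Z^d$ be a lattice, $N=\operatorname{Hom}(M,\mathbb Z)$, $E$ a finite set, $r\in\mathbb Z^E$, and let $a=(a_e)_{e\in E}$ be primitive vectors of $N$ that generate $N$. Let $\mathcal A$ be the arrangement of the affine hyperplanes $H_e=\{m\in M_{\mathbb R}:\langle m,a_e\rangle+r_e=0\}$, with closed half-spaces $H_e^{+}=\{\langle m,a_e\rangle+r_e\le 0\}$ and $H_e^{-}=\{\langle m,a_e\rangle+r_e\ge 0\}$, and let $\mathcal A_0=\mathcal A(a,0)$ be its centralization, with hyperplanes $(H_e)_0$. For $S\subseteq E$ put $H_S=\bigcap_{e\in S}(H_e)_0$ and $\operatorname{rk}S=\operatorname{codim}H_S$; $S$ is a flat of $\mathcal A_0$ if $S=\{e\in E:(H_e)_0\supseteq H_S\}$. A face $\mathcal R$ of the localization $\mathcal A_S=\{H_e\}_{e\in S}$ is a nonempty set of all points of $M_{\mathbb R}$ having prescribed signs with respect to the $H_e$, $e\in S$; put $S^{\pm}(\mathcal R)=\{e\in S:\mathcal R\subseteq H_e^{\pm}\}$, and let $\operatorname{codim}\mathcal R$ be the codimension of the intersection of all $H_e$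 $(e\in S)$ that contain $\mathcal R$. Let $\Lambda=\{c\in\mathbb Z^E:\sum_e c_ea_e=0\}$, let $\widetilde N=(\mathbb Z^E\oplus\mathbb Z^E)/\{(c,-c):c\in\Lambda\}$, with $\rho_e^+,\rho_e^-$ the images of the basis vectors of the two summands, and let $\widetilde M=\operatorname{Hom}(\widetilde N,\mathbb Z)$. Let $\sigma_{S,\mathcal R}\subseteq\widetilde N_{\mathbb R}$ be the cone generated by the $\rho_e^+$, $e\in S^+(\mathcal R)$, and the $\rho_f^-$, $f\in S^-(\mathcal R)$. Let $K$ be a field, and let the Lawrence toric variety $\mathfrak B_{\mathcal A}$ be the toric variety over $K$ of the fan $\{\sigma_{S,\mathcal R}: S\subseteq E,\ \mathcal R\text{ a face of }\mathcal A_S\}$, with torus orbits $O(\sigma)=\operatorname{Spec}K[\sigma^\perp\cap\widetilde M]$. Let $\Phi:\mathfrak B_{\mathcal A}\to\mathbb A^E=\operatorname{Spec}K[x_e\mid e\in E]$ be the toric morphism induced by $\widetilde N\to\mathbb Z^E$, $\rho_e^\pm\mapsto\delta_e$, let $L_{\mathcal A_0}\subseteq\mathbb A^E$ be the linear space cut out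 by the forms $\sum_e c_ex_e$, $c\in\Lambda$, and let the hypertoric variety be $\mathfrak M_{\mathcal A}=\Phi^{-1}(L_{\mathcal A_0})\subseteq\mathfrak B_{\mathcal A}$. Assume that $K$ has characteristic $0$ or, more generally, that for every $T\subseteq E$ the vectors $a_e\otimes 1\in N\otimes K$, $e\in T$, span a $K$-subspace of dimension $\operatorname{rk}T$ (this also holds over every field if $\mathcal A$ is unimodular). **Proposition 5.1.** Let $S\subseteq E$ and let $\mathcal R$ be a face of $\mathcal A_S$. The intersection $\mathfrak M_{\mathcal A}\cap O(\sigma_{S,\mathcal R})$ is nonempty if and only if $S$ is a flat of $\mathcal A_0$. In that case it is a linear subvariety of the torus $O(\sigma_{S,\mathcal R})$, that is, a closed subscheme whose ideal is generated by linear forms in the characters $x_1,\dots,x_n$ corresponding to some $\mathbb Z$-basis of the character lattice $\sigma_{S,\mathcal R}^\perp\cap\widetilde M$; it is reduced and irreducible, of dimension $2d-\operatorname{rk}S-\operatorname{codim}\mathcal R$. -/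

import Mathlib

open scoped TensorProduct
open CategoryTheory CategoryTheory.Limits AlgebraicGeometry

universe u

namespace Hypertoric

noncomputable section

section Toric

variable {L : Type u} [AddCommGroup L]

/-- The extension `⟨u, ·⟩ : L_ℝ → ℝ` of `u ∈ Hom(L, ℤ)` to `L_ℝ = ℝ ⊗ L`. -/
def pairing (u : Module.Dual ℤ L) : (ℝ ⊗[ℤ] L) →ₗ[ℝ] ℝ :=
  Module.Dual.baseChange ℝ u

theorem pairing_tmul (u : Module.Dual ℤ L) (t : ℝ) (g : L) :
    pairing u (t ⊗ₜ g) = (u g : ℝ) * t := by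
  simp [pairing, Module.Dual.baseChange]

theorem pairing_add (u v : Module.Dual ℤ L) (x : ℝ ⊗[ℤ] L) :
    pairing (u + v) x = pairing u x + pairing v x := by
  induction x with
  | zero => simp
  | tmul t g => simp [pairing_tmul, add_mul]
  | add x y hx hy => simp only [map_add, hx, hy]; ring

theorem pairing_zero (x : ℝ ⊗[ℤ] L) : pairing (0 : Module.Dual ℤ L) x = 0 := by
  have := pairing_add (0 : Module.Dual ℤ L) 0 x
  simpa using this

theorem pairing_neg (v : Module.Dual ℤ L) (x : ℝ ⊗[ℤ] L) :
    pairing (-v) x = - pairing v x := by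
  have := pairing_add v (-v) x
  rw [add_neg_cancel, pairing_zero] at this
  linarith

theorem pairing_nsmul (k : ℕ) (v : Module.Dual ℤ L) (x : ℝ ⊗[ℤ] L) :
    pairing (k • v) x = k * pairing v x := by
  induction k with
  | zero => simp [pairing_zero]
  | succ k ih => rw [succ_nsmul, pairing_add, ih]; push_cast; ring

/-- The monoid `σ^∨ ∩ Hom(L, ℤ)` of lattice points of the dual cone. -/
def dualMonoid (σ : PointedCone ℝ (ℝ ⊗[ℤ] L)) : AddSubmonoid (Module.Dual ℤ L) where
  carrier := {u | ∀ x ∈ σ, 0 ≤ pairing u x}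
  zero_mem' := fun x _ => (pairing_zero x).ge
  add_mem' := fun {u v} hu hv x hx => by
    rw [pairing_add]; exact add_nonneg (hu x hx) (hv x hx)

/-- The lattice `σ^⊥ ∩ Hom(L, ℤ)`. -/
def perpLattice (σ : PointedCone ℝ (ℝ ⊗[ℤ] L)) : Submodule ℤ (Module.Dual ℤ L) :=
  AddSubgroup.toIntSubmodule
    { carrier := {u | ∀ x ∈ σ, pairing u x = 0}
      zero_mem' := fun x _ => pairing_zero x
      add_mem' := fun {u v} hu hv x hx => by rw [pairing_add, hu x hx, hv x hx, add_zero]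
      neg_mem' := fun {u} hu x hx => by rw [pairing_neg, hu x hx, neg_zero] }

theorem mem_perpLattice {σ : PointedCone ℝ (ℝ ⊗[ℤ] L)} {u : Module.Dual ℤ L} :
    u ∈ perpLattice σ ↔ ∀ x ∈ σ, pairing u x = 0 := Iff.rfl

theorem mem_dualMonoid {σ : PointedCone ℝ (ℝ ⊗[ℤ] L)} {u : Module.Dual ℤ L} :
    u ∈ dualMonoid σ ↔ ∀ x ∈ σ, 0 ≤ pairing u x := Iff.rfl

theorem dualMonoid_anti {σ τ : PointedCone ℝ (ℝ ⊗[ℤ] L)} (h : τ ≤ σ) :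
    dualMonoid σ ≤ dualMonoid τ := fun _ hu x hx => hu x (h hx)

/-- Rational polyhedral cone: generated by finitely many lattice vectors. -/
def IsRationalCone (σ : PointedCone ℝ (ℝ ⊗[ℤ] L)) : Prop :=
  ∃ G : Set L, G.Finite ∧ σ = PointedCone.hull ℝ ((fun g => (1 : ℝ) ⊗ₜ[ℤ] g) '' G)

/-- `τ ≺ σ`: the cone `τ` is the face `σ ∩ u^⊥` of `σ` for some `u ∈ σ^∨ ∩ Hom(L, ℤ)`. (For a
rational polyhedral cone, these are all the faces.) -/
def IsConeFace (τ σ : PointedCone ℝ (ℝ ⊗[ℤ] L)) : Prop :=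
  ∃ u ∈ dualMonoid σ, ∀ x, x ∈ τ ↔ x ∈ σ ∧ pairing u x = 0

theorem IsConeFace.le {τ σ : PointedCone ℝ (ℝ ⊗[ℤ] L)} (h : IsConeFace τ σ) : τ ≤ σ := by
  obtain ⟨u, _, h⟩ := h
  exact fun x hx => ((h x).1 hx).1

theorem IsConeFace.refl (σ : PointedCone ℝ (ℝ ⊗[ℤ] L)) : IsConeFace σ σ :=
  ⟨0, zero_mem _, fun x => by simp [pairing_zero]⟩

theorem mem_dualMonoid_hull {G : Set L} {u : Module.Dual ℤ L} :
    u ∈ dualMonoid (PointedCone.hull ℝ ((fun g => (1 : ℝ) ⊗ₜ[ℤ] g) '' G)) ↔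
      ∀ g ∈ G, 0 ≤ u g := by
  constructor
  · intro h g hg
    have := h _ (PointedCone.subset_hull ⟨g, hg, rfl⟩)
    simpa [pairing_tmul] using this
  · intro h x hx
    induction hx using Submodule.span_induction with
    | mem x hx =>
      obtain ⟨g, hg, rfl⟩ := hx
      simpa [pairing_tmul] using h g hg
    | zero => simp
    | add x y _ _ hx hy => rw [map_add]; exact add_nonneg hx hy
    | smul c x _ hx =>
      have : pairing u (c • x) = (c : ℝ) * pairing u x := by
        rw [← smul_eq_mul, ← map_smul]; rfl
      rw [this]; exact mul_nonneg c.2 hx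

theorem hull_inter_perp {G : Set L} {u : Module.Dual ℤ L} (h : ∀ g ∈ G, 0 ≤ u g)
    (x : ℝ ⊗[ℤ] L) :
    x ∈ PointedCone.hull ℝ ((fun g => (1 : ℝ) ⊗ₜ[ℤ] g) '' {g ∈ G | u g = 0}) ↔
      x ∈ PointedCone.hull ℝ ((fun g => (1 : ℝ) ⊗ₜ[ℤ] g) '' G) ∧ pairing u x = 0 := by
  have key : ∀ c : {c : ℝ // 0 ≤ c}, ∀ x : ℝ ⊗[ℤ] L,
      pairing u (c • x) = (c : ℝ) * pairing u x := fun c x => by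
    rw [← smul_eq_mul, ← map_smul]; rfl
  constructor
  · intro hx
    refine ⟨Submodule.span_mono (Set.image_mono (Set.sep_subset _ _)) hx, ?_⟩
    induction hx using Submodule.span_induction with
    | mem x hx =>
      obtain ⟨g, hg, rfl⟩ := hx
      simp [pairing_tmul, hg.2]
    | zero => simp
    | add x y _ _ hx hy => rw [map_add, hx, hy, add_zero]
    | smul c x _ hx => rw [key, hx, mul_zero]
  · rintro ⟨hx, h0⟩
    have hnn := mem_dualMonoid_hull.2 h
    induction hx using Submodule.span_induction with
    | mem x hx =>
      obtain ⟨g, hg, rfl⟩ := hx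
      refine PointedCone.subset_hull ⟨g, ⟨hg, ?_⟩, rfl⟩
      simpa [pairing_tmul] using h0
    | zero => exact zero_mem _
    | add x y hx' hy' hx hy =>
      have h1 := hnn x hx'
      have h2 := hnn y hy'
      rw [map_add] at h0
      exact add_mem (hx (by linarith)) (hy (by linarith))
    | smul c x hx' hx =>
      rw [key] at h0
      rcases mul_eq_zero.1 h0 with h | h
      · have : c = 0 := Subtype.ext h
        rw [this, zero_smul]; exact zero_mem _
      · exact Submodule.smul_mem _ _ (hx h)

theorem exists_add_nsmul_mem {σ τ : PointedCone ℝ (ℝ ⊗[ℤ] L)} (hσ : IsRationalCone σ)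
    {u : Module.Dual ℤ L} (hu : u ∈ dualMonoid σ)
    (hτ : ∀ x, x ∈ τ ↔ x ∈ σ ∧ pairing u x = 0) {v : Module.Dual ℤ L}
    (hv : v ∈ dualMonoid τ) : ∃ k : ℕ, v + k • u ∈ dualMonoid σ := by
  obtain ⟨G, hG, rfl⟩ := hσ
  refine ⟨∑ g ∈ hG.toFinset, (v g).natAbs, mem_dualMonoid_hull.2 fun g hg => ?_⟩
  have hle : (v g).natAbs ≤ ∑ g ∈ hG.toFinset, (v g).natAbs :=
    Finset.single_le_sum (f := fun g => (v g).natAbs) (fun _ _ => Nat.zero_le _)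
      (hG.mem_toFinset.2 hg)
  have hug := mem_dualMonoid_hull.1 hu g hg
  rw [LinearMap.add_apply, LinearMap.smul_apply, nsmul_eq_mul]
  rcases hug.eq_or_lt with h0 | h0
  · have : 0 ≤ pairing v ((1 : ℝ) ⊗ₜ[ℤ] g) :=
      hv _ ((hτ _).2 ⟨PointedCone.subset_hull ⟨g, hg, rfl⟩, by simp [pairing_tmul, ← h0]⟩)
    rw [← h0, mul_zero, add_zero]
    simpa [pairing_tmul] using this
  · have h1 : -((v g).natAbs : ℤ) ≤ v g := by omega
    have h2 : ((v g).natAbs : ℤ) ≤ ((∑ g ∈ hG.toFinset, (v g).natAbs : ℕ) : ℤ) := by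
      exact_mod_cast hle
    nlinarith

theorem IsConeFace.trans {ρ τ σ : PointedCone ℝ (ℝ ⊗[ℤ] L)} (hσ : IsRationalCone σ)
    (h₁ : IsConeFace ρ τ) (h₂ : IsConeFace τ σ) : IsConeFace ρ σ := by
  obtain ⟨v, hv, hρ⟩ := h₁
  obtain ⟨u, hu, hτ⟩ := h₂
  obtain ⟨k, hk⟩ := exists_add_nsmul_mem hσ hu hτ hv
  refine ⟨v + k • u + u, add_mem hk hu, fun x => ?_⟩
  rw [hρ, hτ]
  constructor
  · rintro ⟨⟨h1, h2⟩, h3⟩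
    exact ⟨h1, by simp [pairing_add, pairing_nsmul, h2, h3]⟩
  · rintro ⟨h1, h2⟩
    have h3 := hk x h1
    have h4 := hu x h1
    rw [pairing_add] at h2
    have h5 : pairing u x = 0 := by linarith
    have h6 : pairing (v + k • u) x = 0 := by linarith
    refine ⟨⟨h1, h5⟩, ?_⟩
    simpa [pairing_add, pairing_nsmul, h5] using h6

/-- The affine toric chart `Y_σ = Spec K[σ^∨ ∩ Hom(L, ℤ)]`. -/
abbrev chart (K : Type u) [Field K] (σ : PointedCone ℝ (ℝ ⊗[ℤ] L)) : Scheme.{u} :=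
  Spec (CommRingCat.of (AddMonoidAlgebra K (dualMonoid σ)))

/-- The inclusion of rings `K[σ^∨ ∩ Hom(L, ℤ)] → K[τ^∨ ∩ Hom(L, ℤ)]` for `τ ⊆ σ`. -/
def chartRingHom (K : Type u) [Field K] {τ σ : PointedCone ℝ (ℝ ⊗[ℤ] L)} (h : τ ≤ σ) :
    AddMonoidAlgebra K (dualMonoid σ) →+* AddMonoidAlgebra K (dualMonoid τ) :=
  AddMonoidAlgebra.mapDomainRingHom K (AddSubmonoid.inclusion (dualMonoid_anti h))

/-- The morphism `Y_τ → Y_σ` for `τ ⊆ σ`. -/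
def chartMap (K : Type u) [Field K] {τ σ : PointedCone ℝ (ℝ ⊗[ℤ] L)} (h : τ ≤ σ) :
    chart K τ ⟶ chart K σ :=
  Spec.map (CommRingCat.ofHom (chartRingHom K h))

theorem chartMap_refl (K : Type u) [Field K] (σ : PointedCone ℝ (ℝ ⊗[ℤ] L)) :
    chartMap K (le_refl σ) = 𝟙 (chart K σ) := by
  have h : chartRingHom K (le_refl σ) = RingHom.id _ :=
    AddMonoidAlgebra.mapDomainRingHom_id
  rw [chartMap, h]
  exact Spec.map_id _

theorem chartMap_comp (K : Type u) [Field K] {ρ τ σ : PointedCone ℝ (ℝ ⊗[ℤ] L)}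
    (h₁ : ρ ≤ τ) (h₂ : τ ≤ σ) :
    chartMap K h₁ ≫ chartMap K h₂ = chartMap K (h₁.trans h₂) := by
  have h : chartRingHom K (h₁.trans h₂) = (chartRingHom K h₁).comp (chartRingHom K h₂) :=
    by
      unfold chartRingHom
      rw [← AddMonoidAlgebra.mapDomainRingHom_comp]
      rfl
  rw [chartMap, chartMap, chartMap, h, ← Spec.map_comp, ← CommRingCat.ofHom_comp]

theorem isLocalizationAway_chartRingHom (K : Type u) [Field K]
    {τ σ : PointedCone ℝ (ℝ ⊗[ℤ] L)} (hσ : IsRationalCone σ) (h : τ ≤ σ)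
    {u : Module.Dual ℤ L} (hu : u ∈ dualMonoid σ)
    (hτ : ∀ x, x ∈ τ ↔ x ∈ σ ∧ pairing u x = 0) :
    letI := (chartRingHom K h).toAlgebra
    IsLocalization.Away
      (AddMonoidAlgebra.single (⟨u, hu⟩ : dualMonoid σ) (1 : K))
      (AddMonoidAlgebra K (dualMonoid τ)) := by
  let _ := (chartRingHom K h).toAlgebra
  have halg : ∀ (v : dualMonoid σ) (c : K),
      algebraMap (AddMonoidAlgebra K (dualMonoid σ)) (AddMonoidAlgebra K (dualMonoid τ))
        (AddMonoidAlgebra.single v c) =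
      AddMonoidAlgebra.single (⟨v.1, dualMonoid_anti h v.2⟩ : dualMonoid τ) c := fun v c =>
    AddMonoidAlgebra.mapDomain_single
  have hneg : -u ∈ dualMonoid τ := fun x hx => by
    rw [pairing_neg, ((hτ x).1 hx).2, neg_zero]
  have hunit : IsUnit (algebraMap (AddMonoidAlgebra K (dualMonoid σ))
      (AddMonoidAlgebra K (dualMonoid τ))
        (AddMonoidAlgebra.single (⟨u, hu⟩ : dualMonoid σ) (1 : K))) := by
    refine IsUnit.of_mul_eq_one
      (AddMonoidAlgebra.single (⟨-u, hneg⟩ : dualMonoid τ) (1 : K)) ?_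
    rw [halg, AddMonoidAlgebra.single_mul_single, AddMonoidAlgebra.one_def]
    congr 1
    · exact Subtype.ext (add_neg_cancel u)
    · simp
  have hinj : Function.Injective (algebraMap (AddMonoidAlgebra K (dualMonoid σ))
      (AddMonoidAlgebra K (dualMonoid τ))) :=
    AddMonoidAlgebra.mapDomain_injective (AddSubmonoid.inclusion_injective _)
  refine IsLocalization.Away.mk _ hunit (fun z => ?_) (fun a b hab => ⟨0, by rw [hinj hab]⟩)
  induction z using AddMonoidAlgebra.induction_linear with
  | zero => exact ⟨0, 0, by simp⟩
  | add z w hz hw =>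
    obtain ⟨n, a, ha⟩ := hz
    obtain ⟨m, b, hb⟩ := hw
    refine ⟨n + m, a * AddMonoidAlgebra.single (⟨u, hu⟩ : dualMonoid σ) (1 : K) ^ m +
      b * AddMonoidAlgebra.single (⟨u, hu⟩ : dualMonoid σ) (1 : K) ^ n, ?_⟩
    rw [map_add, map_mul, map_mul, ← ha, ← hb, map_pow, map_pow]
    ring
  | single v c =>
    obtain ⟨k, hk⟩ := exists_add_nsmul_mem hσ hu hτ v.2
    refine ⟨k, AddMonoidAlgebra.single (⟨v.1 + k • u, hk⟩ : dualMonoid σ) c, ?_⟩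
    rw [halg, halg, AddMonoidAlgebra.single_pow, AddMonoidAlgebra.single_mul_single, one_pow,
      mul_one]
    congr 1

theorem range_chartMap (K : Type u) [Field K]
    {τ σ : PointedCone ℝ (ℝ ⊗[ℤ] L)} (hσ : IsRationalCone σ) (h : τ ≤ σ)
    {u : Module.Dual ℤ L} (hu : u ∈ dualMonoid σ)
    (hτ : ∀ x, x ∈ τ ↔ x ∈ σ ∧ pairing u x = 0) :
    Set.range (chartMap K h) =
      {p : PrimeSpectrum (AddMonoidAlgebra K (dualMonoid σ)) |
        AddMonoidAlgebra.single (⟨u, hu⟩ : dualMonoid σ) (1 : K) ∉ p.asIdeal} := by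
  let _ := (chartRingHom K h).toAlgebra
  have := isLocalizationAway_chartRingHom K hσ h hu hτ
  exact PrimeSpectrum.localization_away_comap_range (AddMonoidAlgebra K (dualMonoid τ))
    (AddMonoidAlgebra.single (⟨u, hu⟩ : dualMonoid σ) (1 : K))

theorem isOpenImmersion_chartMap (K : Type u) [Field K]
    {τ σ : PointedCone ℝ (ℝ ⊗[ℤ] L)} (hσ : IsRationalCone σ) (h : IsConeFace τ σ) :
    IsOpenImmersion (chartMap K h.le) := by
  obtain ⟨u, hu, hτ⟩ := id h
  let _ := (chartRingHom K h.le).toAlgebra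
  have := isLocalizationAway_chartRingHom K hσ h.le hu hτ
  exact IsOpenImmersion.of_isLocalization
    (AddMonoidAlgebra.single (⟨u, hu⟩ : dualMonoid σ) (1 : K))

/-- A collection of rational polyhedral cones in `L_ℝ` that contains every face of each of its
members. Every rational polyhedral fan is one; for a fan, `σ ∩ σ'` is the largest common face of `σ`
and `σ'`, so gluing along all common faces is gluing along `Y_{σ ∩ σ'}`. -/
structure ConeSystem (L : Type u) [AddCommGroup L] where
  cones : Set (PointedCone ℝ (ℝ ⊗[ℤ] L))
  rational : ∀ σ ∈ cones, IsRationalCone σ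
  face_mem : ∀ σ ∈ cones, ∀ τ, IsConeFace τ σ → τ ∈ cones

/-- The cones of `Δ`, as a category with one morphism `τ ⟶ σ` whenever `τ` is a face of `σ`. -/
@[ext]
structure ConeSystem.Cone (Δ : ConeSystem L) where
  cone : PointedCone ℝ (ℝ ⊗[ℤ] L)
  mem : cone ∈ Δ.cones

instance (Δ : ConeSystem L) : Preorder Δ.Cone where
  le τ σ := IsConeFace τ.cone σ.cone
  le_refl σ := IsConeFace.refl σ.cone
  le_trans _ _ σ h₁ h₂ := h₁.trans (Δ.rational _ σ.mem) h₂

/-- The diagram of affine charts `Y_σ`, `σ ∈ Δ`, with the inclusions `Y_τ → Y_σ` for `τ ≺ σ`. -/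
def ConeSystem.diagram (K : Type u) [Field K] (Δ : ConeSystem L) : Δ.Cone ⥤ Scheme.{u} where
  obj σ := chart K σ.cone
  map f := chartMap K (leOfHom f).le
  map_id σ := chartMap_refl K σ.cone
  map_comp f g := (chartMap_comp K (leOfHom f).le (leOfHom g).le).symm

instance (K : Type u) [Field K] (Δ : ConeSystem L) {τ σ : Δ.Cone} (f : τ ⟶ σ) :
    IsOpenImmersion ((Δ.diagram K).map f) :=
  isOpenImmersion_chartMap K (Δ.rational _ σ.mem) (leOfHom f)

instance (K : Type u) [Field K] (Δ : ConeSystem L) :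
    (Δ.diagram K ⋙ Scheme.forget).IsLocallyDirected where
  cond {τ₁ τ₂ σ} f₁ f₂ x₁ x₂ hx := by
    obtain ⟨u₁, hu₁, h₁⟩ := id (leOfHom f₁)
    obtain ⟨u₂, hu₂, h₂⟩ := id (leOfHom f₂)
    have hσ := Δ.rational _ σ.mem
    let ρ : PointedCone ℝ (ℝ ⊗[ℤ] L) := τ₁.cone ⊓ τ₂.cone
    have hρ : ∀ x, x ∈ ρ ↔ x ∈ σ.cone ∧ pairing (u₁ + u₂) x = 0 := fun x => by
      rw [Submodule.mem_inf, h₁, h₂, pairing_add]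
      constructor
      · rintro ⟨⟨h, h'⟩, -, h''⟩
        exact ⟨h, by rw [h', h'', add_zero]⟩
      · rintro ⟨h, h'⟩
        have := hu₁ x h
        have := hu₂ x h
        exact ⟨⟨h, by linarith⟩, h, by linarith⟩
    have hρσ : IsConeFace ρ σ.cone := ⟨u₁ + u₂, add_mem hu₁ hu₂, hρ⟩
    have hρ₁ : IsConeFace ρ τ₁.cone :=
      ⟨u₂, dualMonoid_anti (leOfHom f₁).le hu₂, fun x => by
        rw [Submodule.mem_inf, h₂]
        exact ⟨fun h => ⟨h.1, h.2.2⟩, fun h => ⟨h.1, (leOfHom f₁).le h.1, h.2⟩⟩⟩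
    have hρ₂ : IsConeFace ρ τ₂.cone :=
      ⟨u₁, dualMonoid_anti (leOfHom f₂).le hu₁, fun x => by
        rw [Submodule.mem_inf, h₁]
        exact ⟨fun h => ⟨h.2, h.1.2⟩, fun h => ⟨⟨(leOfHom f₂).le h.1, h.2⟩, h.1⟩⟩⟩
    let l : Δ.Cone := ⟨ρ, Δ.face_mem _ σ.mem _ hρσ⟩
    let g₁ : l ⟶ τ₁ := homOfLE hρ₁
    let g₂ : l ⟶ τ₂ := homOfLE hρ₂
    let y : chart K σ.cone := (Δ.diagram K).map f₁ x₁
    have hy₂ : y = (Δ.diagram K).map f₂ x₂ := hx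
    have hy1 : y ∈ Set.range (chartMap K (leOfHom f₁).le) := ⟨x₁, rfl⟩
    have hy2 : y ∈ Set.range (chartMap K (leOfHom f₂).le) := ⟨x₂, hy₂.symm⟩
    rw [range_chartMap K hσ _ hu₁ h₁] at hy1
    rw [range_chartMap K hσ _ hu₂ h₂] at hy2
    have hy : y ∈ Set.range (chartMap K hρσ.le) := by
      rw [range_chartMap K hσ _ (add_mem hu₁ hu₂) hρ]
      have hmul : AddMonoidAlgebra.single (⟨u₁ + u₂, add_mem hu₁ hu₂⟩ : dualMonoid σ.cone) (1 : K) =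
          AddMonoidAlgebra.single (⟨u₁, hu₁⟩ : dualMonoid σ.cone) (1 : K) *
          AddMonoidAlgebra.single (⟨u₂, hu₂⟩ : dualMonoid σ.cone) (1 : K) := by
        rw [AddMonoidAlgebra.single_mul_single, mul_one]
        rfl
      change AddMonoidAlgebra.single (⟨u₁ + u₂, add_mem hu₁ hu₂⟩ : dualMonoid σ.cone) (1 : K) ∉
        PrimeSpectrum.asIdeal y
      rw [hmul]
      exact fun h => (Ideal.IsPrime.mem_or_mem (PrimeSpectrum.isPrime y) h).elim hy1 hy2
    obtain ⟨x, hx'⟩ := hy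
    have hc₁ : chartMap K (leOfHom f₁).le (chartMap K hρ₁.le x) = y := by
      rw [← hx', ← Scheme.Hom.comp_apply, chartMap_comp]
    have hc₂ : chartMap K (leOfHom f₂).le (chartMap K hρ₂.le x) = y := by
      rw [← hx', ← Scheme.Hom.comp_apply, chartMap_comp]
    exact ⟨l, g₁, g₂, x, ((Δ.diagram K).map f₁).isOpenEmbedding.injective hc₁,
      ((Δ.diagram K).map f₂).isOpenEmbedding.injective (hc₂.trans hy₂)⟩

/-- The toric scheme `Y_Δ`: the charts `Y_σ`, `σ ∈ Δ`, glued along the open subschemes `Y_τ` of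
their common faces `τ`. -/
def ConeSystem.toricScheme (K : Type u) [Field K] (Δ : ConeSystem L) : Scheme.{u} :=
  colimit (Δ.diagram K)

/-- The inclusion of the chart `Y_σ` in `Y_Δ`. -/
def ConeSystem.chartι (K : Type u) [Field K] (Δ : ConeSystem L) (σ : Δ.Cone) :
    chart K σ.cone ⟶ Δ.toricScheme K :=
  colimit.ι (Δ.diagram K) σ

/-- The torus orbit `O(σ) = Spec K[σ^⊥ ∩ Hom(L, ℤ)]`. -/
abbrev orbit (K : Type u) [Field K] (σ : PointedCone ℝ (ℝ ⊗[ℤ] L)) : Scheme.{u} :=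
  Spec (CommRingCat.of (AddMonoidAlgebra K (perpLattice σ)))

theorem mem_perpLattice_of_add {σ : PointedCone ℝ (ℝ ⊗[ℤ] L)} (u v : dualMonoid σ) :
    (u : Module.Dual ℤ L) + v ∈ perpLattice σ ↔
      (u : Module.Dual ℤ L) ∈ perpLattice σ ∧ (v : Module.Dual ℤ L) ∈ perpLattice σ := by
  refine ⟨fun h => ?_, fun h => add_mem h.1 h.2⟩
  have key : ∀ x ∈ σ, pairing (u : Module.Dual ℤ L) x = 0 ∧ pairing (v : Module.Dual ℤ L) x = 0 :=
    fun x hx => by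
      have h1 := u.2 x hx
      have h2 := v.2 x hx
      have h3 := h x hx
      rw [pairing_add] at h3
      constructor <;> linarith
  exact ⟨fun x hx => (key x hx).1, fun x hx => (key x hx).2⟩

open Classical in
/-- The surjection `K[σ^∨ ∩ Hom(L, ℤ)] → K[σ^⊥ ∩ Hom(L, ℤ)]` with `χ^u ↦ χ^u` if `u ∈ σ^⊥` and
`χ^u ↦ 0` otherwise. -/
def orbitRingHom (K : Type u) [Field K] (σ : PointedCone ℝ (ℝ ⊗[ℤ] L)) :
    AddMonoidAlgebra K (dualMonoid σ) →ₐ[K] AddMonoidAlgebra K (perpLattice σ) :=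
  AddMonoidAlgebra.lift K _ _
    { toFun := fun u =>
        if h : (u.toAdd : Module.Dual ℤ L) ∈ perpLattice σ then
          AddMonoidAlgebra.single ⟨(u.toAdd : Module.Dual ℤ L), h⟩ 1
        else 0
      map_one' := by
        have h : (0 : Module.Dual ℤ L) ∈ perpLattice σ := zero_mem _
        exact dif_pos h
      map_mul' := fun u v => by
        have huv := mem_perpLattice_of_add u.toAdd v.toAdd
        by_cases hu : (u.toAdd : Module.Dual ℤ L) ∈ perpLattice σ <;>
          by_cases hv : (v.toAdd : Module.Dual ℤ L) ∈ perpLattice σ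
        · have h := huv.2 ⟨hu, hv⟩
          simp only [toAdd_mul, AddSubmonoid.coe_add, hu, hv, h, dite_true]
          rw [AddMonoidAlgebra.single_mul_single, mul_one]
          rfl
        all_goals
          have h : ¬ ((u.toAdd : Module.Dual ℤ L) + v.toAdd ∈ perpLattice σ) := fun h => by
            simpa [hu, hv] using huv.1 h
          simp [hu, hv, h] }

/-- The closed immersion `O(σ) → Y_σ`. -/
def orbitToChart (K : Type u) [Field K] (σ : PointedCone ℝ (ℝ ⊗[ℤ] L)) :
    orbit K σ ⟶ chart K σ :=
  Spec.map (CommRingCat.ofHom (orbitRingHom K σ).toRingHom)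

/-- The inclusion of the torus orbit `O(σ)` in `Y_Δ`. -/
def ConeSystem.orbitι (K : Type u) [Field K] (Δ : ConeSystem L) (σ : Δ.Cone) :
    orbit K σ.cone ⟶ Δ.toricScheme K :=
  orbitToChart K σ.cone ≫ Δ.chartι K σ

/-- A morphism `Z → Spec K[P]` to the torus with character lattice `P` is (the inclusion of) a
linear subvariety if it is the inclusion of a closed subscheme whose ideal is generated by linear
forms `∑ j, c j • x_j` in the characters `x_j = χ^{b j}` of some basis `b` of the lattice `P`. -/
def IsLinearSubvariety {K : Type u} [Field K] {P : Type u} [AddCommGroup P] {Z : Scheme.{u}}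
    (i : Z ⟶ Spec (CommRingCat.of (AddMonoidAlgebra K P))) : Prop :=
  ∃ (n : ℕ) (b : Module.Basis (Fin n) ℤ P) (C : Set (Fin n → K)),
    let I : Ideal (AddMonoidAlgebra K P) :=
      Ideal.span ((fun c => ∑ j, AddMonoidAlgebra.single (b j) (c j)) '' C)
    ∃ e : Z ≅ Spec (CommRingCat.of (AddMonoidAlgebra K P ⧸ I)),
      e.hom ≫ Spec.map (CommRingCat.ofHom (Ideal.Quotient.mk I)) = i

end Toric

/-- An arrangement `𝒜(a, r)` of cooriented affine hyperplanes in `M_ℝ = ℝ ⊗ M`, indexed by `E`, with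
normal vectors `a_e ∈ N = Hom(M, ℤ)` and offsets `r_e ∈ ℤ`, such that `a` is a primitive spanning
configuration. (A primitive vector is in particular nonzero.) -/
structure Arrangement (M E : Type u) [AddCommGroup M] where
  normal : E → Module.Dual ℤ M
  offset : E → ℤ
  primitive : ∀ (e : E) (k : ℤ) (v : Module.Dual ℤ M), normal e = k • v → IsUnit k
  spanning : Submodule.span ℤ (Set.range normal) = ⊤

namespace Arrangement

section Combinatorics

variable {M E : Type u} [AddCommGroup M] (A : Arrangement M E)

/-- The affine function `m ↦ ⟨m, a_e⟩ + r_e` on `M_ℝ`. -/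
def affineForm (e : E) (m : ℝ ⊗[ℤ] M) : ℝ := pairing (A.normal e) m + A.offset e

/-- The hyperplane `H_e`. -/
def hyperplane (e : E) : Set (ℝ ⊗[ℤ] M) := {m | A.affineForm e m = 0}

/-- The closed halfspace `H_e^+`. -/
def posHalfspace (e : E) : Set (ℝ ⊗[ℤ] M) := {m | A.affineForm e m ≤ 0}

/-- The closed halfspace `H_e^-`. -/
def negHalfspace (e : E) : Set (ℝ ⊗[ℤ] M) := {m | 0 ≤ A.affineForm e m}

/-- The hyperplane `(H_e)_0` of the centralization `𝒜_0`. -/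
def centralHyperplane (e : E) : Submodule ℝ (ℝ ⊗[ℤ] M) := LinearMap.ker (pairing (A.normal e))

/-- The subspace `H_S`, the intersection of the `(H_e)_0` for `e ∈ S`. -/
def centralFlat (S : Set E) : Submodule ℝ (ℝ ⊗[ℤ] M) := ⨅ e ∈ S, A.centralHyperplane e

/-- The rank of `S`, which is the codimension of `H_S` in `M_ℝ`. -/
def rank (S : Set E) : ℕ := Module.finrank ℝ ((ℝ ⊗[ℤ] M) ⧸ A.centralFlat S)

/-- `S` is a flat of `𝒜_0`, that is, `S = {e | (H_e)_0 ⊇ H_S}`. -/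
def IsFlat (S : Set E) : Prop := S = {e | A.centralFlat S ≤ A.centralHyperplane e}

/-- The dimension over `K` of the span of the vectors `1 ⊗ a_e`, `e ∈ S`, in `K ⊗ N`. -/
def rankOver (K : Type u) [Field K] (S : Set E) : ℕ :=
  Module.finrank K
    (Submodule.span K ((fun e => (1 : K) ⊗ₜ[ℤ] A.normal e) '' S) :
      Submodule K (K ⊗[ℤ] Module.Dual ℤ M))

/-- The sign of `m` at `e`: positive on `H_e^+ \ H_e`, zero on `H_e`, negative on `H_e^- \ H_e`. -/
def sgn (m : ℝ ⊗[ℤ] M) (e : E) : SignType := -SignType.sign (A.affineForm e m)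

/-- `R` is a face of the localization `𝒜_S`: a nonempty fiber of `m ↦ (sgn m e)_{e ∈ S}`. -/
def IsFace (S : Set E) (R : Set (ℝ ⊗[ℤ] M)) : Prop :=
  ∃ m, R = {m' | ∀ e ∈ S, A.sgn m' e = A.sgn m e}

/-- `S^+(R)`. -/
def posIndex (S : Set E) (R : Set (ℝ ⊗[ℤ] M)) : Set E := {e ∈ S | R ⊆ A.posHalfspace e}

/-- `S^-(R)`. -/
def negIndex (S : Set E) (R : Set (ℝ ⊗[ℤ] M)) : Set E := {e ∈ S | R ⊆ A.negHalfspace e}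

/-- `S^0(R)`, the set of `e ∈ S` with `R ⊆ H_e`. -/
def zeroIndex (S : Set E) (R : Set (ℝ ⊗[ℤ] M)) : Set E := A.posIndex S R ∩ A.negIndex S R

/-- The codimension in `M_ℝ` of a face `R` of `𝒜_S`: the codimension of the affine subspace which
is the intersection of all `H_e`, `e ∈ S`, that contain `R`. -/
def codim (S : Set E) (R : Set (ℝ ⊗[ℤ] M)) : ℕ :=
  Module.finrank ℝ
    ((ℝ ⊗[ℤ] M) ⧸ vectorSpan ℝ (⋂ e ∈ A.zeroIndex S R, A.hyperplane e))

theorem mem_posIndex {S : Set E} {m : ℝ ⊗[ℤ] M} {e : E} :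
    e ∈ A.posIndex S {m' | ∀ e ∈ S, A.sgn m' e = A.sgn m e} ↔ e ∈ S ∧ A.affineForm e m ≤ 0 := by
  constructor
  · rintro ⟨he, h⟩
    exact ⟨he, h (show m ∈ _ from fun _ _ => rfl)⟩
  · rintro ⟨he, h⟩
    refine ⟨he, fun m' hm' => ?_⟩
    have h1 : SignType.sign (A.affineForm e m') = SignType.sign (A.affineForm e m) :=
      neg_injective (hm' e he)
    change A.affineForm e m' ≤ 0
    by_contra! hpos
    rw [sign_pos hpos] at h1
    exact absurd (sign_eq_one_iff.1 h1.symm) (not_lt.2 h)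

theorem mem_negIndex {S : Set E} {m : ℝ ⊗[ℤ] M} {e : E} :
    e ∈ A.negIndex S {m' | ∀ e ∈ S, A.sgn m' e = A.sgn m e} ↔ e ∈ S ∧ 0 ≤ A.affineForm e m := by
  constructor
  · rintro ⟨he, h⟩
    exact ⟨he, h (show m ∈ _ from fun _ _ => rfl)⟩
  · rintro ⟨he, h⟩
    refine ⟨he, fun m' hm' => ?_⟩
    have h1 : SignType.sign (A.affineForm e m') = SignType.sign (A.affineForm e m) :=
      neg_injective (hm' e he)
    change 0 ≤ A.affineForm e m'
    by_contra! hneg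
    rw [sign_neg hneg] at h1
    exact absurd (sign_eq_neg_one_iff.1 h1.symm) (not_lt.2 h)

end Combinatorics

section Lawrence

variable {M E : Type u} [AddCommGroup M] [Fintype E] (A : Arrangement M E)

/-- The homomorphism `ℤ^E → N`, `δ_e ↦ a_e`. -/
def normalHom : (E → ℤ) →ₗ[ℤ] Module.Dual ℤ M := Fintype.linearCombination ℤ A.normal

/-- The lattice `Λ` of relations `∑ c_e a_e = 0`. -/
def relations : Submodule ℤ (E → ℤ) := LinearMap.ker A.normalHom

/-- The antidiagonal embedding `∇ : ℤ^E → ℤ^E ⊕ ℤ^E`. -/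
def antidiagonal (E : Type u) : (E → ℤ) →ₗ[ℤ] (E → ℤ) × (E → ℤ) :=
  LinearMap.prod LinearMap.id (-LinearMap.id)

/-- The lattice `Ñ`, the cokernel of `Λ → ℤ^E → ℤ^E ⊕ ℤ^E`. -/
abbrev lawrenceLattice : Type u := ((E → ℤ) × (E → ℤ)) ⧸ A.relations.map (antidiagonal E)

open Classical in
/-- The element `ρ_e^+` of `Ñ`. -/
def rhoPos (e : E) : A.lawrenceLattice := Submodule.Quotient.mk (Pi.single e 1, 0)

open Classical in
/-- The element `ρ_e^-` of `Ñ`. -/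
def rhoNeg (e : E) : A.lawrenceLattice := Submodule.Quotient.mk (0, Pi.single e 1)

/-- The surjection `Ñ → ℤ^E`, `ρ_e^± ↦ δ_e`. -/
def toCoordinates : A.lawrenceLattice →ₗ[ℤ] (E → ℤ) :=
  Submodule.liftQ _ (LinearMap.coprod LinearMap.id LinearMap.id) (by
    rintro _ ⟨c, _, rfl⟩
    simp [antidiagonal])

/-- The character of the Lawrence torus which is the pullback, under the homomorphism of tori given
by `Ñ → ℤ^E`, of the coordinate `x_e`. -/
def coordinateCharacter (e : E) : Module.Dual ℤ A.lawrenceLattice :=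
  (LinearMap.proj e : (E → ℤ) →ₗ[ℤ] ℤ) ∘ₗ A.toCoordinates

/-- The ray generators `ρ_e^+`, `e ∈ S^+(R)`, and `ρ_f^-`, `f ∈ S^-(R)`, of the cone `σ_{S,R}`. -/
def rayGenerators (S : Set E) (R : Set (ℝ ⊗[ℤ] M)) : Set A.lawrenceLattice :=
  A.rhoPos '' A.posIndex S R ∪ A.rhoNeg '' A.negIndex S R

/-- The cone `σ_{S,R}` in `Ñ_ℝ`. -/
def lawrenceCone (S : Set E) (R : Set (ℝ ⊗[ℤ] M)) : PointedCone ℝ (ℝ ⊗[ℤ] A.lawrenceLattice) :=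
  PointedCone.hull ℝ ((fun g => (1 : ℝ) ⊗ₜ[ℤ] g) '' A.rayGenerators S R)

theorem isRationalCone_lawrenceCone (S : Set E) (R : Set (ℝ ⊗[ℤ] M)) :
    IsRationalCone (A.lawrenceCone S R) :=
  ⟨A.rayGenerators S R, ((Set.toFinite _).image _).union ((Set.toFinite _).image _), rfl⟩

theorem coordinateCharacter_mem (S : Set E) (R : Set (ℝ ⊗[ℤ] M)) (e : E) :
    A.coordinateCharacter e ∈ dualMonoid (A.lawrenceCone S R) := by
  classical
  refine mem_dualMonoid_hull.2 ?_
  rintro _ (⟨f, _, rfl⟩ | ⟨f, _, rfl⟩)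
  · change 0 ≤ (Pi.single f 1 + 0 : E → ℤ) e
    rw [add_zero, Pi.single_apply]
    split_ifs <;> norm_num
  · change 0 ≤ (0 + Pi.single f 1 : E → ℤ) e
    rw [zero_add, Pi.single_apply]
    split_ifs <;> norm_num

theorem exists_normal_apply_eq [Module.Free ℤ M] [Module.Finite ℤ M]
    (u : Module.Dual ℤ A.lawrenceLattice) :
    ∃ m : M, ∀ e, A.normal e m = u (A.rhoPos e) - u (A.rhoNeg e) := by
  classical
  let w : (E → ℤ) →ₗ[ℤ] ℤ :=
    u ∘ₗ (A.relations.map (antidiagonal E)).mkQ ∘ₗ antidiagonal E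
  have hw : LinearMap.ker A.normalHom ≤ LinearMap.ker w := fun c hc => by
    have h0 : (A.relations.map (antidiagonal E)).mkQ (antidiagonal E c) = 0 :=
      (Submodule.Quotient.mk_eq_zero _).2 ⟨c, hc, rfl⟩
    change u _ = 0
    rw [LinearMap.comp_apply, h0, map_zero]
  have hsurj : Function.Surjective A.normalHom := by
    rw [← LinearMap.range_eq_top, normalHom, Fintype.range_linearCombination, A.spanning]
  let φ : Module.Dual ℤ (Module.Dual ℤ M) :=
    (LinearMap.ker A.normalHom).liftQ w hw ∘ₗ
      (A.normalHom.quotKerEquivOfSurjective hsurj).symm.toLinearMap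
  refine ⟨(Module.evalEquiv ℤ M).symm φ, fun e => ?_⟩
  rw [Module.apply_evalEquiv_symm_apply]
  have h1 : A.normalHom (Pi.single e 1) = A.normal e := by
    simp [normalHom, Fintype.linearCombination_apply_single]
  have h2 : φ (A.normalHom (Pi.single e 1)) = w (Pi.single e 1) := by
    have h3 : (A.normalHom.quotKerEquivOfSurjective hsurj).symm (A.normalHom (Pi.single e 1)) =
        Submodule.Quotient.mk (Pi.single e 1) := by
      rw [LinearEquiv.symm_apply_eq]; rfl
    change (LinearMap.ker A.normalHom).liftQ w hw _ = _
    erw [h3]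
    rfl
  rw [← h1, h2]
  have h4 : antidiagonal E (Pi.single e 1) =
      ((Pi.single e 1, 0) : (E → ℤ) × (E → ℤ)) - (0, Pi.single e 1) := by
    ext <;> simp [antidiagonal]
  change u (Submodule.Quotient.mk (antidiagonal E (Pi.single e 1))) = _
  rw [h4, Submodule.Quotient.mk_sub, map_sub]
  rfl

theorem face_lawrenceCone [Module.Free ℤ M] [Module.Finite ℤ M] {S : Set E}
    {R : Set (ℝ ⊗[ℤ] M)} (hR : A.IsFace S R)
    {τ : PointedCone ℝ (ℝ ⊗[ℤ] A.lawrenceLattice)} (hτ : IsConeFace τ (A.lawrenceCone S R)) :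
    ∃ (S' : Set E) (R' : Set (ℝ ⊗[ℤ] M)), A.IsFace S' R' ∧ τ = A.lawrenceCone S' R' := by
  obtain ⟨p, rfl⟩ := hR
  obtain ⟨u, hu, hτ⟩ := hτ
  set R : Set (ℝ ⊗[ℤ] M) := {m' | ∀ e ∈ S, A.sgn m' e = A.sgn p e} with hRdef
  have hu' := mem_dualMonoid_hull.1 hu
  obtain ⟨m, hm⟩ := A.exists_normal_apply_eq u
  have hform : ∀ (ε : ℝ) (e : E), A.affineForm e (p + ε ⊗ₜ[ℤ] m) =
      A.affineForm e p + ((u (A.rhoPos e) : ℝ) - u (A.rhoNeg e)) * ε := fun ε e => by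
    simp only [affineForm, map_add, pairing_tmul, hm e]
    push_cast
    ring
  have hev : ∀ᶠ ε : ℝ in nhdsWithin 0 (Set.Ioi 0), 0 < ε ∧ ∀ e,
      (A.affineForm e p < 0 → A.affineForm e (p + ε ⊗ₜ[ℤ] m) < 0) ∧
      (0 < A.affineForm e p → 0 < A.affineForm e (p + ε ⊗ₜ[ℤ] m)) := by
    refine (eventually_mem_nhdsWithin).and ?_
    rw [Filter.eventually_all]
    intro e
    have hcont : Filter.Tendsto (fun ε : ℝ => A.affineForm e (p + ε ⊗ₜ[ℤ] m))
        (nhdsWithin 0 (Set.Ioi 0)) (nhds (A.affineForm e p)) := by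
      simp only [hform]
      refine Filter.Tendsto.mono_left ?_ nhdsWithin_le_nhds
      have : Continuous fun ε : ℝ =>
          A.affineForm e p + ((u (A.rhoPos e) : ℝ) - u (A.rhoNeg e)) * ε := by fun_prop
      simpa using this.tendsto 0
    rcases lt_trichotomy (A.affineForm e p) 0 with h | h | h
    · filter_upwards [hcont.eventually_lt_const h] with ε hε
      exact ⟨fun _ => hε, fun h' => absurd h' (not_lt.2 h.le)⟩
    · exact Filter.Eventually.of_forall fun ε =>
        ⟨fun h' => absurd h h'.ne, fun h' => absurd h h'.ne'⟩
    · filter_upwards [hcont.eventually_const_lt h] with ε hε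
      exact ⟨fun h' => absurd h' (not_lt.2 h.le), fun _ => hε⟩
  obtain ⟨ε, hε, hsign⟩ := hev.exists
  let P : Set E := {e ∈ A.posIndex S R | u (A.rhoPos e) = 0}
  let Q : Set E := {e ∈ A.negIndex S R | u (A.rhoNeg e) = 0}
  have hzero : ∀ e ∈ S, A.affineForm e p = 0 →
      (0 : ℝ) ≤ u (A.rhoPos e) ∧ (0 : ℝ) ≤ u (A.rhoNeg e) := fun e he h0 => by
    have h1 := hu' _ (Or.inl ⟨e, A.mem_posIndex.2 ⟨he, h0.le⟩, rfl⟩)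
    have h2 := hu' _ (Or.inr ⟨e, A.mem_negIndex.2 ⟨he, h0.ge⟩, rfl⟩)
    exact ⟨by exact_mod_cast h1, by exact_mod_cast h2⟩
  have hP : A.posIndex (P ∪ Q)
      {m' | ∀ e ∈ P ∪ Q, A.sgn m' e = A.sgn (p + ε ⊗ₜ[ℤ] m) e} = P := by
    ext e
    rw [mem_posIndex]
    constructor
    · rintro ⟨he | he, h⟩
      · exact he
      · obtain ⟨heS, hnn⟩ := A.mem_negIndex.1 he.1
        rcases hnn.eq_or_lt with h0 | h0
        · obtain ⟨h1, -⟩ := hzero e heS h0.symm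
          rw [hform, ← h0, he.2] at h
          refine ⟨A.mem_posIndex.2 ⟨heS, h0.ge⟩, ?_⟩
          have h2 : (u (A.rhoPos e) : ℝ) = 0 := by
            push_cast at h
            have : (u (A.rhoPos e) : ℝ) * ε ≤ 0 := by linarith
            nlinarith
          exact_mod_cast h2
        · exact absurd ((hsign e).2 h0) (not_lt.2 h)
    · intro he
      obtain ⟨heS, hnp⟩ := A.mem_posIndex.1 he.1
      refine ⟨Or.inl he, ?_⟩
      rcases hnp.eq_or_lt with h0 | h0
      · obtain ⟨-, h1⟩ := hzero e heS h0
        rw [hform, h0, he.2]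
        push_cast
        nlinarith
      · exact ((hsign e).1 h0).le
  have hQ : A.negIndex (P ∪ Q)
      {m' | ∀ e ∈ P ∪ Q, A.sgn m' e = A.sgn (p + ε ⊗ₜ[ℤ] m) e} = Q := by
    ext e
    rw [mem_negIndex]
    constructor
    · rintro ⟨he | he, h⟩
      · obtain ⟨heS, hnp⟩ := A.mem_posIndex.1 he.1
        rcases hnp.eq_or_lt with h0 | h0
        · obtain ⟨-, h1⟩ := hzero e heS h0
          rw [hform, h0, he.2] at h
          refine ⟨A.mem_negIndex.2 ⟨heS, h0.ge⟩, ?_⟩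
          have h2 : (u (A.rhoNeg e) : ℝ) = 0 := by
            push_cast at h
            have : (u (A.rhoNeg e) : ℝ) * ε ≤ 0 := by linarith
            nlinarith
          exact_mod_cast h2
        · exact absurd ((hsign e).1 h0) (not_lt.2 h)
      · exact he
    · intro he
      obtain ⟨heS, hnn⟩ := A.mem_negIndex.1 he.1
      refine ⟨Or.inr he, ?_⟩
      rcases hnn.eq_or_lt with h0 | h0
      · obtain ⟨h1, -⟩ := hzero e heS h0.symm
        rw [hform, ← h0, he.2]
        push_cast
        nlinarith
      · exact ((hsign e).2 h0).le
  refine ⟨P ∪ Q, {m' | ∀ e ∈ P ∪ Q, A.sgn m' e = A.sgn (p + ε ⊗ₜ[ℤ] m) e}, ⟨_, rfl⟩, ?_⟩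
  have hrays : A.rayGenerators (P ∪ Q)
      {m' | ∀ e ∈ P ∪ Q, A.sgn m' e = A.sgn (p + ε ⊗ₜ[ℤ] m) e} =
      {g ∈ A.rayGenerators S R | u g = 0} := by
    rw [rayGenerators, hP, hQ]
    ext g
    constructor
    · rintro (⟨e, he, rfl⟩ | ⟨e, he, rfl⟩)
      · exact ⟨Or.inl ⟨e, he.1, rfl⟩, he.2⟩
      · exact ⟨Or.inr ⟨e, he.1, rfl⟩, he.2⟩
    · rintro ⟨⟨e, he, rfl⟩ | ⟨e, he, rfl⟩, h0⟩
      · exact Or.inl ⟨e, ⟨he, h0⟩, rfl⟩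
      · exact Or.inr ⟨e, ⟨he, h0⟩, rfl⟩
  ext x
  rw [hτ, lawrenceCone, lawrenceCone, hrays, hull_inter_perp hu']

/-- The Lawrence fan `Δ_𝒜`, consisting of the cones `σ_{S,R}` for all subsets `S` of `E` and all
faces `R` of `𝒜_S`. -/
def lawrenceFan [Module.Free ℤ M] [Module.Finite ℤ M] : ConeSystem A.lawrenceLattice where
  cones := {σ | ∃ (S : Set E) (R : Set (ℝ ⊗[ℤ] M)), A.IsFace S R ∧ σ = A.lawrenceCone S R}
  rational := by
    rintro _ ⟨S, R, _, rfl⟩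
    exact A.isRationalCone_lawrenceCone S R
  face_mem := by
    rintro _ ⟨S, R, hR, rfl⟩ τ hτ
    exact A.face_lawrenceCone hR hτ

variable [Module.Free ℤ M] [Module.Finite ℤ M] (K : Type u) [Field K]

/-- The Lawrence toric variety `𝔅_𝒜`. -/
def lawrenceVariety : Scheme.{u} := A.lawrenceFan.toricScheme K

/-- The cone `σ_{S,R}` as an element of the Lawrence fan. -/
def fanCone {S : Set E} {R : Set (ℝ ⊗[ℤ] M)} (hR : A.IsFace S R) : A.lawrenceFan.Cone :=
  ⟨A.lawrenceCone S R, S, R, hR, rfl⟩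

/-- The inclusion of the orbit `O(σ_{S,R})` in `𝔅_𝒜`. -/
def orbitι {S : Set E} {R : Set (ℝ ⊗[ℤ] M)} (hR : A.IsFace S R) :
    orbit K (A.lawrenceCone S R) ⟶ A.lawrenceVariety K :=
  A.lawrenceFan.orbitι K (A.fanCone hR)

/-- The affine space `𝔸^E = Spec K[x_e | e ∈ E]`. -/
abbrev affineSpace (K : Type u) [Field K] (E : Type u) : Scheme.{u} :=
  Spec (CommRingCat.of (MvPolynomial E K))

theorem coordinateCharacter_mem_cone (σ : A.lawrenceFan.Cone) (e : E) :
    A.coordinateCharacter e ∈ dualMonoid σ.cone := by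
  obtain ⟨σ, S, R, _, rfl⟩ := σ
  exact A.coordinateCharacter_mem S R e

/-- The restriction of `Φ` to the chart `Y_σ`: it pulls the coordinate `x_e` back to the
corresponding character. -/
def phiChart (σ : A.lawrenceFan.Cone) : chart K σ.cone ⟶ affineSpace K E :=
  Spec.map (CommRingCat.ofHom
    (MvPolynomial.aeval (R := K) fun e =>
      AddMonoidAlgebra.single
        (⟨A.coordinateCharacter e, A.coordinateCharacter_mem_cone σ e⟩ : dualMonoid σ.cone)
        (1 : K)).toRingHom)

theorem chartMap_phiChart {τ σ : A.lawrenceFan.Cone} (h : τ.cone ≤ σ.cone) :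
    chartMap K h ≫ A.phiChart K σ = A.phiChart K τ := by
  unfold chartMap phiChart
  rw [← Spec.map_comp, ← CommRingCat.ofHom_comp]
  congr 2
  refine MvPolynomial.ringHom_ext (fun c => ?_) (fun e => ?_)
  · simp [chartRingHom]
  · simp only [chartRingHom, AlgHom.toRingHom_eq_coe, RingHom.comp_apply, RingHom.coe_coe,
      MvPolynomial.aeval_X]
    exact AddMonoidAlgebra.mapDomain_single

/-- The morphism of toric varieties `Φ : 𝔅_𝒜 → 𝔸^E` induced by `Ñ → ℤ^E`. -/
def phi : A.lawrenceVariety K ⟶ affineSpace K E :=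
  colimit.desc (A.lawrenceFan.diagram K)
    { pt := affineSpace K E
      ι :=
        { app := fun σ => A.phiChart K σ
          naturality := fun _ _ f =>
            (A.chartMap_phiChart K (leOfHom f).le).trans (Category.comp_id _).symm } }

/-- The ideal of the linear space `L_{𝒜_0} ⊆ 𝔸^E`, generated by the linear forms `∑ c_e x_e` for
the relations `∑ c_e a_e = 0`. -/
def linearIdeal : Ideal (MvPolynomial E K) :=
  Ideal.span ((fun c : E → ℤ => ∑ e, MvPolynomial.C (c e : K) * MvPolynomial.X e) ''
    (A.relations : Set (E → ℤ)))

/-- The linear space `L_{𝒜_0}`. -/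
abbrev linearSpace : Scheme.{u} :=
  Spec (CommRingCat.of (MvPolynomial E K ⧸ A.linearIdeal K))

/-- The inclusion of `L_{𝒜_0}` in `𝔸^E`. -/
def linearSpaceι : A.linearSpace K ⟶ affineSpace K E :=
  Spec.map (CommRingCat.ofHom (Ideal.Quotient.mk (A.linearIdeal K)))

/-- The hypertoric variety `𝔐_𝒜`, the preimage of `L_{𝒜_0}` under `Φ`. -/
def hypertoricVariety : Scheme.{u} := pullback (A.phi K) (A.linearSpaceι K)

/-- The inclusion of `𝔐_𝒜` in `𝔅_𝒜`. -/
def hypertoricι : A.hypertoricVariety K ⟶ A.lawrenceVariety K :=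
  pullback.fst (A.phi K) (A.linearSpaceι K)

/-- The intersection `𝔐_𝒜 ∩ O(σ_{S,R})` in `𝔅_𝒜`. -/
def orbitIntersection {S : Set E} {R : Set (ℝ ⊗[ℤ] M)} (hR : A.IsFace S R) : Scheme.{u} :=
  pullback (A.hypertoricι K) (A.orbitι K hR)

/-- The inclusion of `𝔐_𝒜 ∩ O(σ_{S,R})` in `O(σ_{S,R})`. -/
def orbitIntersectionι {S : Set E} {R : Set (ℝ ⊗[ℤ] M)} (hR : A.IsFace S R) :
    A.orbitIntersection K hR ⟶ orbit K (A.lawrenceCone S R) :=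
  pullback.snd (A.hypertoricι K) (A.orbitι K hR)

end Lawrence

end Arrangement

end

end Hypertoric

/-! On the orbit `O(σ_{S,R})` the coordinate `x_e` vanishes for `e ∈ S`, because one of `ρ_e^±` is a
ray of the cone. For `e ∉ S` it restricts to a character. These characters form part of a basis of
`σ^⊥`; the complement is a copy of the annihilator in `M` of the `a_e` with `R ⊆ H_e`, of rank `d -
codim R` (`perpLatticeEquiv`, `finrank_annihilator_add_rank`). Hence the intersection with `𝔐_𝒜` is
cut out of the torus by honest linear forms, the relations `c ∈ Λ` restricted to `E ∖ S`
(`linearIdeal_perpLatticeBasis`). Over `K` these span the kernel of the surjection `K^{E∖S} → (K ⊗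
N)/⟨a_e, e ∈ S⟩` (`span_restrict_relations`).

A linear system on a torus defines a linear space minus the coordinate hyperplanes. This is empty if
some coordinate lies in the span of the forms; otherwise it is a nonempty open part of an affine
space, so integral of the expected dimension (`quotient_linearForms`). The coordinate `x_f` lies in
the span exactly when `a_f` lies in the `K`-span of the `a_e`, `e ∈ S`. As ranks over `K` agree with
ranks over `ℝ`, this says that `(H_f)_0 ⊇ H_S` (`centralFlat_le_iff`), so nonemptiness means that
`S` is a flat. The torus has dimension `|E∖S| + d - codim R` and there are `|E∖S| - d + rk S`
independent forms; the difference is `2d - rk S - codim R`. -/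

/-! ### Krull dimension of a basic open subset of affine space -/

theorem ringKrullDim_le_of_isIntegral {R S : Type*} [CommRing R] [CommRing S] [Algebra R S]
    [Algebra.IsIntegral R S] [IsDomain R] [IsDomain S] [FaithfulSMul R S] :
    ringKrullDim R ≤ ringKrullDim S := by
  refine iSup_le fun l => ?_
  -- Lying over lifts the smallest prime of the chain, and going up lifts the rest without changing
  -- the length.
  obtain ⟨p, -, hp, hlo⟩ := Ideal.exists_ideal_over_prime_of_isIntegral (S := S) l.head.asIdeal ⊥
    (by simp [Ideal.comap_bot_of_injective _ (FaithfulSMul.algebraMap_injective R S)])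
  have : p.LiesOver l.head.asIdeal := ⟨hlo.symm⟩
  obtain ⟨L, hL, -⟩ := Ideal.exists_ltSeries_of_hasGoingUp l p
  rw [← hL]
  exact le_iSup (fun p : LTSeries (PrimeSpectrum S) => (p.length : WithBot ℕ∞)) L

theorem trdeg_eq_of_isAlgebraic {K A B : Type u} [Field K] [CommRing A] [CommRing B] [IsDomain A]
    [IsDomain B]
    [Algebra K A] [Algebra K B] [Algebra A B] [IsScalarTower K A B] [FaithfulSMul A B]
    [Algebra.IsAlgebraic A B] : Algebra.trdeg K A = Algebra.trdeg K B := by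
  rw [← trdeg_add_eq K A (A := B), trdeg_eq_zero (R := A), add_zero]

/-- The upper bound holds because primes of a localization embed in those of the ring. For the lower
bound no chain at a rational point is available in general, since over a finite field `f` may vanish
at all of them; Noether normalization and transcendence degree are used instead. -/
theorem ringKrullDim_of_isLocalization_away_mvPolynomial {K : Type u} [Field K] {n : ℕ}
    {f : MvPolynomial (Fin n) K} (hf : f ≠ 0) (B : Type u) [CommRing B]
    [Algebra (MvPolynomial (Fin n) K) B] [IsLocalization.Away f B] :
    IsDomain B ∧ ringKrullDim B = n := by
  have hle : Submonoid.powers f ≤ nonZeroDivisors _ :=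
    powers_le_nonZeroDivisors_of_noZeroDivisors hf
  have : IsDomain B := IsLocalization.isDomain_of_le_nonZeroDivisors _ hle
  have hinj : Function.Injective (algebraMap (MvPolynomial (Fin n) K) B) :=
    IsLocalization.injective B hle
  refine ⟨this, ?_⟩
  have hpoly : ∀ s : ℕ, ringKrullDim (MvPolynomial (Fin s) K) = s := fun s => by
    rw [MvPolynomial.ringKrullDim_of_isNoetherianRing, ringKrullDim_eq_zero_of_field]
    simp
  apply le_antisymm
  · rw [← hpoly n]
    refine Order.krullDim_le_of_strictMono
      (PrimeSpectrum.comap (algebraMap (MvPolynomial (Fin n) K) B)) ?_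
    exact fun p q h => (IsLocalization.orderEmbedding (Submonoid.powers f) B).strictMono h
  · let _ : Algebra K B := ((algebraMap (MvPolynomial (Fin n) K) B).comp
      (algebraMap K (MvPolynomial (Fin n) K))).toAlgebra
    have : IsScalarTower K (MvPolynomial (Fin n) K) B := .of_algebraMap_eq' rfl
    have : FaithfulSMul (MvPolynomial (Fin n) K) B :=
      (faithfulSMul_iff_algebraMap_injective _ _).2 hinj
    have : Algebra.IsAlgebraic (MvPolynomial (Fin n) K) B :=
      IsLocalization.isAlgebraic B (Submonoid.powers f)
    have h1 : Algebra.trdeg K B = n := by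
      rw [← trdeg_eq_of_isAlgebraic (A := MvPolynomial (Fin n) K), MvPolynomial.trdeg_of_isDomain]
      simp
    have : Algebra.FiniteType (MvPolynomial (Fin n) K) B :=
      IsLocalization.finiteType_of_monoid_fg (Submonoid.powers f) B
    have : Algebra.FiniteType K B := .trans inferInstance this
    -- The number `s` of normalizing variables is the transcendence degree of `B`, which is already
    -- known to be `n`.
    obtain ⟨s, g, hg, hint⟩ := exists_integral_inj_algHom_of_fg K B
    let _ := g.toRingHom.toAlgebra
    have : IsScalarTower K (MvPolynomial (Fin s) K) B :=
      .of_algebraMap_eq fun x => (g.commutes x).symm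
    have : FaithfulSMul (MvPolynomial (Fin s) K) B :=
      (faithfulSMul_iff_algebraMap_injective _ _).2 hg
    have : Algebra.IsIntegral (MvPolynomial (Fin s) K) B := ⟨hint⟩
    have h2 : Algebra.trdeg K B = s := by
      rw [← trdeg_eq_of_isAlgebraic (A := MvPolynomial (Fin s) K), MvPolynomial.trdeg_of_isDomain]
      simp
    have h3 : s = n := by exact_mod_cast h2.symm.trans h1
    subst h3
    rw [← hpoly s]
    exact ringKrullDim_le_of_isIntegral

/-! ### Linear substitutions in polynomial rings -/

namespace MvPolynomial

/-- The linear form `∑ v_i x_i` with coefficient vector `v`. -/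
noncomputable def linearForm (K : Type*) [Field K] (ι : Type*) [Fintype ι] :
    (ι → K) →ₗ[K] MvPolynomial ι K :=
  Fintype.linearCombination K X

variable {K : Type*} [Field K] {ι κ : Type*} [Fintype ι] [Fintype κ]

theorem linearForm_apply (v : ι → K) : linearForm K ι v = ∑ i, C (v i) * X i := by
  simp [linearForm, Fintype.linearCombination_apply, smul_eq_C_mul]

theorem linearForm_single [DecidableEq ι] (i : ι) :
    linearForm K ι (Pi.single i 1) = X i := by
  simp [linearForm, Fintype.linearCombination_apply_single]

theorem linearForm_injective : Function.Injective (linearForm K ι) :=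
  (linearIndependent_X ι K).fintypeLinearCombination_injective

/-- The homomorphism of polynomial rings which acts on linear forms by `φ`. -/
noncomputable def linearSubst [DecidableEq ι] (φ : (ι → K) →ₗ[K] (κ → K)) :
    MvPolynomial ι K →ₐ[K] MvPolynomial κ K :=
  aeval fun i => linearForm K κ (φ (Pi.single i 1))

theorem linearSubst_linearForm [DecidableEq ι] (φ : (ι → K) →ₗ[K] (κ → K)) (v : ι → K) :
    linearSubst φ (linearForm K ι v) = linearForm K κ (φ v) := by
  refine LinearMap.congr_fun (f := (linearSubst φ).toLinearMap ∘ₗ linearForm K ι)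
    (g := linearForm K κ ∘ₗ φ) ?_ v
  refine LinearMap.pi_ext' fun i => LinearMap.ext_ring ?_
  simp [linearForm_single, linearSubst]

theorem linearSubst_surjective [DecidableEq ι] [DecidableEq κ] {φ : (ι → K) →ₗ[K] (κ → K)}
    (hφ : Function.Surjective φ) : Function.Surjective (linearSubst φ) := by
  rw [← AlgHom.range_eq_top, eq_top_iff, ← adjoin_range_X, Algebra.adjoin_le_iff]
  rintro _ ⟨j, rfl⟩
  obtain ⟨v, hv⟩ := hφ (Pi.single j 1)
  exact ⟨linearForm K ι v, by simp [linearSubst_linearForm, hv, linearForm_single]⟩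

/-- A linear section `g` of `φ` satisfies `v - g (φ v) ∈ ker φ`, so substituting by `φ` and then by
`g` is the identity modulo the forms from `s`. A polynomial killed by the first substitution is
therefore zero modulo these forms. -/
theorem ker_linearSubst_le [DecidableEq ι] [DecidableEq κ] {φ : (ι → K) →ₗ[K] (κ → K)}
    (hφ : Function.Surjective φ) {s : Set (ι → K)} (hs : LinearMap.ker φ ≤ Submodule.span K s) :
    RingHom.ker (linearSubst φ) ≤ Ideal.span (linearForm K ι '' s) := by
  obtain ⟨g, hg⟩ := φ.exists_rightInverse_of_surjective (LinearMap.range_eq_top.2 hφ)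
  set J := Ideal.span (linearForm K ι '' s)
  have hJ : Submodule.span K s ≤ (J.restrictScalars K).comap (linearForm K ι) :=
    Submodule.span_le.2 fun v hv => Ideal.subset_span ⟨v, hv, rfl⟩
  have key : ((Ideal.Quotient.mkₐ K J).comp (linearSubst g)).comp (linearSubst φ) =
      Ideal.Quotient.mkₐ K J := by
    refine algHom_ext fun i => ?_
    rw [← linearForm_single (K := K), AlgHom.comp_apply, AlgHom.comp_apply, linearSubst_linearForm,
      linearSubst_linearForm]
    refine (Ideal.Quotient.eq.2 ?_)
    rw [← map_sub]
    refine hJ (hs ?_)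
    rw [LinearMap.mem_ker, map_sub, ← LinearMap.comp_apply φ g, hg, LinearMap.id_apply, sub_self]
  intro p hp
  have := DFunLike.congr_fun key p
  rw [AlgHom.comp_apply, (RingHom.mem_ker).1 hp, map_zero] at this
  exact Ideal.Quotient.eq_zero_iff_mem.1 this.symm

end MvPolynomial

/-! ### Linear subvarieties of a torus -/

section Torus

variable {K : Type u} [Field K] {P : Type u} [AddCommGroup P] {ι : Type*}
  (b : Module.Basis ι ℤ P)

/-- The exponent vectors `ℕ^ι` in the lattice with basis `b`. -/
noncomputable def Module.Basis.exponent : (ι →₀ ℕ) →+ P :=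
  (Finsupp.liftAddHom fun i => (multiplesHom P (b i)))

theorem Module.Basis.exponent_single (i : ι) (n : ℕ) :
    b.exponent (Finsupp.single i n) = n • b i := by
  simp [Module.Basis.exponent]

theorem Module.Basis.repr_exponent (v : ι →₀ ℕ) (i : ι) : b.repr (b.exponent v) i = v i := by
  classical
  induction v using Finsupp.induction_linear with
  | zero => simp
  | add v w hv hw => simp [hv, hw]
  | single j n => simp [exponent_single, Finsupp.single_apply]

theorem Module.Basis.exponent_injective : Function.Injective b.exponent := fun v w h => by
  ext i
  have := b.repr_exponent v i
  rw [h, b.repr_exponent] at this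
  exact_mod_cast this.symm

variable (K) in
/-- The inclusion of the polynomial ring in the ring of Laurent polynomials. -/
noncomputable def Module.Basis.toLaurent : MvPolynomial ι K →+* AddMonoidAlgebra K P :=
  AddMonoidAlgebra.mapDomainRingHom K b.exponent

theorem Module.Basis.toLaurent_X (i : ι) :
    b.toLaurent K (MvPolynomial.X i) = AddMonoidAlgebra.single (b i) 1 := by
  rw [← one_nsmul (b i), ← b.exponent_single]
  exact AddMonoidAlgebra.mapDomain_single

theorem Module.Basis.toLaurent_C (c : K) :
    b.toLaurent K (MvPolynomial.C c) = AddMonoidAlgebra.single 0 c := by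
  rw [← map_zero b.exponent]
  exact AddMonoidAlgebra.mapDomain_single

variable [Fintype ι]

theorem Module.Basis.toLaurent_linearForm (v : ι → K) :
    b.toLaurent K (MvPolynomial.linearForm K ι v) = ∑ i, AddMonoidAlgebra.single (b i) (v i) := by
  rw [MvPolynomial.linearForm_apply, map_sum]
  refine Finset.sum_congr rfl fun i _ => ?_
  rw [map_mul, toLaurent_X, toLaurent_C, AddMonoidAlgebra.single_mul_single, zero_add, mul_one]

theorem Module.Basis.isLocalization_toLaurent :
    letI := (b.toLaurent K).toAlgebra
    IsLocalization.Away (∏ i, MvPolynomial.X i : MvPolynomial ι K) (AddMonoidAlgebra K P) := by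
  classical
  let _ := (b.toLaurent K).toAlgebra
  have halg : algebraMap (MvPolynomial ι K) (AddMonoidAlgebra K P) = b.toLaurent K := rfl
  have hprod : b.toLaurent K (∏ i, MvPolynomial.X i) =
      AddMonoidAlgebra.single (∑ i, b i) 1 := by
    rw [map_prod]
    simp only [toLaurent_X]
    generalize (Finset.univ : Finset ι) = t
    induction t using Finset.induction_on with
    | empty => rfl
    | insert i t hi ih =>
      rw [Finset.prod_insert hi, Finset.sum_insert hi, ih, AddMonoidAlgebra.single_mul_single,
        mul_one]
  have hinj : Function.Injective (b.toLaurent K) :=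
    AddMonoidAlgebra.mapDomain_injective b.exponent_injective
  refine IsLocalization.Away.mk _ ?_ (fun z => ?_)
    (fun x y hxy => ⟨0, by rw [hinj hxy]⟩)
  · rw [halg, hprod]
    refine IsUnit.of_mul_eq_one (AddMonoidAlgebra.single (-∑ i, b i) 1) ?_
    rw [AddMonoidAlgebra.single_mul_single, add_neg_cancel, one_mul, AddMonoidAlgebra.one_def]
  · rw [halg]
    induction z using AddMonoidAlgebra.induction_linear with
    | zero => exact ⟨0, 0, by simp⟩
    | add z w hz hw =>
      obtain ⟨n, x, hx⟩ := hz
      obtain ⟨m, y, hy⟩ := hw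
      refine ⟨n + m, x * (∏ i, MvPolynomial.X i) ^ m + y * (∏ i, MvPolynomial.X i) ^ n, ?_⟩
      rw [map_add, map_mul, map_mul, ← hx, ← hy, map_pow, map_pow]
      ring
    | single p c =>
      -- This `n` bounds every coordinate of `p` in absolute value, so multiplying by the `n`-th
      -- power of the product of all variables makes all exponents nonnegative, and `toNat` below
      -- loses nothing.
      set n := ∑ i, (b.repr p i).natAbs with hn
      refine ⟨n, AddMonoidAlgebra.single
        (Finsupp.equivFunOnFinite.symm fun i => (b.repr p i + n).toNat) c, ?_⟩
      rw [hprod, AddMonoidAlgebra.single_pow, AddMonoidAlgebra.single_mul_single, one_pow, mul_one]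
      refine Eq.trans ?_ AddMonoidAlgebra.mapDomain_single.symm
      congr 1
      refine b.ext_elem fun i => ?_
      have hle : (b.repr p i).natAbs ≤ n :=
        Finset.single_le_sum (f := fun i => (b.repr p i).natAbs) (fun _ _ => Nat.zero_le _)
          (Finset.mem_univ i)
      have h0 : 0 ≤ b.repr p i + n := by omega
      change _ = b.repr (b.exponent _) i
      rw [repr_exponent]
      simp [Finsupp.single_apply, h0]

/-- The ideal of the ring of Laurent polynomials which is generated by the linear forms with
coefficient vectors in `s`. -/
noncomputable def Module.Basis.linearIdeal (s : Set (ι → K)) : Ideal (AddMonoidAlgebra K P) :=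
  Ideal.span ((fun c => ∑ i, AddMonoidAlgebra.single (b i) (c i)) '' s)

theorem Module.Basis.linearIdeal_eq_map (s : Set (ι → K)) :
    b.linearIdeal s = (Ideal.span (MvPolynomial.linearForm K ι '' s)).map (b.toLaurent K) := by
  rw [linearIdeal, Ideal.map_span, ← Set.image_comp]
  simp only [Function.comp_def, toLaurent_linearForm]

open Module

/-- The quotient of the ring of Laurent polynomials by the linear forms with coefficient vectors in
`s` is a domain of dimension `dim K^ι / ⟨s⟩` if no coordinate vanishes modulo these forms. -/
theorem Module.Basis.quotient_linearForms {s : Set (ι → K)} [DecidableEq ι]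
    (hs : ∀ i, Pi.single i 1 ∉ Submodule.span K s) :
    IsDomain (AddMonoidAlgebra K P ⧸ b.linearIdeal s) ∧
    ringKrullDim (AddMonoidAlgebra K P ⧸ b.linearIdeal s) =
      finrank K ((ι → K) ⧸ Submodule.span K s) := by
  set I := b.linearIdeal s
  have hI : I = (Ideal.span (MvPolynomial.linearForm K ι '' s)).map (b.toLaurent K) :=
    b.linearIdeal_eq_map s
  set W := Submodule.span K s
  set d := finrank K ((ι → K) ⧸ W)
  -- Coordinates on `K^ι / W` present the polynomial ring modulo the forms as a polynomial ring in
  -- `d` variables.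
  let e : ((ι → K) ⧸ W) ≃ₗ[K] (Fin d → K) := (Module.finBasis K _).equivFun
  let φ : (ι → K) →ₗ[K] (Fin d → K) := e.toLinearMap ∘ₗ W.mkQ
  have hφ : Function.Surjective φ := e.surjective.comp W.mkQ_surjective
  have hker : LinearMap.ker φ = W := by simp [φ]
  let f := MvPolynomial.linearSubst φ
  have hf : Function.Surjective f := MvPolynomial.linearSubst_surjective hφ
  have hkerf : RingHom.ker f.toRingHom ≤ Ideal.span (MvPolynomial.linearForm K ι '' s) :=
    MvPolynomial.ker_linearSubst_le hφ hker.le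
  have hker0 : ∀ v ∈ s, f (MvPolynomial.linearForm K ι v) = 0 := fun v hv => by
    have : v ∈ LinearMap.ker φ := hker ▸ Submodule.subset_span hv
    rw [MvPolynomial.linearSubst_linearForm, LinearMap.mem_ker.1 this, map_zero]
  have hkerf' : Ideal.span (MvPolynomial.linearForm K ι '' s) = RingHom.ker f.toRingHom :=
    le_antisymm (Ideal.span_le.2 (by rintro _ ⟨v, hv, rfl⟩; exact hker0 v hv)) hkerf
  let _ := (b.toLaurent K).toAlgebra
  have hloc := b.isLocalization_toLaurent (K := K)
  have hg : RingHom.ker f.toRingHom ≤ RingHom.ker ((Ideal.Quotient.mk I).comp (b.toLaurent K)) := by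
    rw [← RingHom.comap_ker, Ideal.mk_ker, ← Ideal.map_le_iff_le_comap, hI]
    exact Ideal.map_mono hkerf
  let _ : Algebra (MvPolynomial (Fin d) K) (AddMonoidAlgebra K P ⧸ I) :=
    (f.toRingHom.liftOfSurjective hf ⟨(Ideal.Quotient.mk I).comp (b.toLaurent K), hg⟩).toAlgebra
  -- Localization commutes with quotients: the Laurent quotient is the polynomial ring in `d`
  -- variables with the image of the product of all `x_i` inverted.
  have hloc' := IsLocalization.of_surjective
    (Submonoid.powers (∏ i, MvPolynomial.X i : MvPolynomial ι K)) (AddMonoidAlgebra K P)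
    f.toRingHom hf (Ideal.Quotient.mk I) Ideal.Quotient.mk_surjective
    (RingHom.ext fun x =>
      (RingHom.liftOfRightInverse_comp_apply f.toRingHom _ (Function.rightInverse_surjInv hf)
        ⟨(Ideal.Quotient.mk I).comp (b.toLaurent K), hg⟩ x).symm)
    (by
      rw [Ideal.mk_ker, hI, hkerf']
      rfl)
  rw [Submonoid.map_powers] at hloc'
  -- Each `x_i` maps to a nonzero linear form by `hs`, and the target is a domain.
  have hne : f.toRingHom (∏ i, MvPolynomial.X i) ≠ 0 := by
    rw [map_prod, Finset.prod_ne_zero_iff]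
    intro i _ h0
    have h1 : f (MvPolynomial.linearForm K ι (Pi.single i 1)) = 0 := by
      rw [MvPolynomial.linearForm_single]; exact h0
    rw [MvPolynomial.linearSubst_linearForm] at h1
    have h2 : Pi.single i 1 ∈ LinearMap.ker φ :=
      MvPolynomial.linearForm_injective (h1.trans (map_zero _).symm)
    exact hs i (hker ▸ h2)
  exact ringKrullDim_of_isLocalization_away_mvPolynomial hne (AddMonoidAlgebra K P ⧸ I)

/-- A coordinate in the span of the forms lies in the ideal, but it is a character and hence a unit.
-/
theorem Module.Basis.quotient_linearForms_subsingleton {s : Set (ι → K)} [DecidableEq ι] {i : ι}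
    (hi : Pi.single i 1 ∈ Submodule.span K s) :
    Subsingleton (AddMonoidAlgebra K P ⧸ b.linearIdeal s) := by
  rw [Ideal.Quotient.subsingleton_iff]
  set I := b.linearIdeal s
  have hI : I = (Ideal.span (MvPolynomial.linearForm K ι '' s)).map (b.toLaurent K) :=
    b.linearIdeal_eq_map s
  have h1 : Submodule.span K s ≤ ((Ideal.span (MvPolynomial.linearForm K ι '' s)).restrictScalars
      K).comap (MvPolynomial.linearForm K ι) :=
    Submodule.span_le.2 fun v hv => Ideal.subset_span ⟨v, hv, rfl⟩
  have h2 : MvPolynomial.X i ∈ Ideal.span (MvPolynomial.linearForm K ι '' s) := by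
    rw [← MvPolynomial.linearForm_single (K := K)]; exact h1 hi
  have h3 := Ideal.mem_map_of_mem (b.toLaurent K) h2
  rw [← hI, toLaurent_X] at h3
  refine Ideal.eq_top_of_isUnit_mem _ h3
    (IsUnit.of_mul_eq_one (AddMonoidAlgebra.single (-b i) 1) ?_)
  rw [AddMonoidAlgebra.single_mul_single, add_neg_cancel, one_mul, AddMonoidAlgebra.one_def]

end Torus

/-! ### The orbit intersection as an affine scheme -/

/-- This is `B ⊗_A A/J = B/JB`; applying `Spec` computes the preimage of a closed subscheme. -/
theorem CommRingCat.isPushout_quotient {A B : Type u} [CommRing A] [CommRing B] (f : A →+* B)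
    (J : Ideal A) {I : Ideal B} (hI : I = J.map f) :
    IsPushout (CommRingCat.ofHom (Ideal.Quotient.mk J)) (CommRingCat.ofHom f)
      (CommRingCat.ofHom (Ideal.quotientMap I f (Ideal.map_le_iff_le_comap.1 hI.ge)))
      (CommRingCat.ofHom (Ideal.Quotient.mk I)) := by
  refine ⟨⟨?_⟩, ⟨PushoutCocone.IsColimit.mk _ (fun s => CommRingCat.ofHom
    (Ideal.Quotient.lift I s.inr.hom ?_)) ?_ ?_ ?_⟩⟩
  · ext a
    simp
  · have h : J.map f ≤ RingHom.ker s.inr.hom := by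
      rw [Ideal.map_le_iff_le_comap]
      intro a ha
      have h1 := congr($(s.condition).hom a)
      change s.inl.hom (Ideal.Quotient.mk J a) = s.inr.hom (f a) at h1
      rw [Ideal.Quotient.eq_zero_iff_mem.2 ha, map_zero] at h1
      exact h1.symm
    exact fun a ha => h (hI ▸ ha)
  · intro s
    ext a
    exact (congr($(s.condition).hom a)).symm
  · intro s
    ext b
    rfl
  · intro s m _ hm
    ext b
    exact congr($(hm).hom b)

namespace Hypertoric.Arrangement

variable {M E : Type u} [AddCommGroup M] [Fintype E] (A : Arrangement M E)
  [Module.Free ℤ M] [Module.Finite ℤ M] (K : Type u) [Field K]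
  {S : Set E} {R : Set (ℝ ⊗[ℤ] M)}

open Classical in
/-- The restriction of the coordinate `x_e` to the orbit `O(σ_{S,R})`. -/
noncomputable def orbitCoordinate (S : Set E) (R : Set (ℝ ⊗[ℤ] M)) (e : E) :
    AddMonoidAlgebra K (perpLattice (A.lawrenceCone S R)) :=
  if h : A.coordinateCharacter e ∈ perpLattice (A.lawrenceCone S R) then
    AddMonoidAlgebra.single ⟨A.coordinateCharacter e, h⟩ 1
  else 0

/-- The orbit factors through the chart of its own cone, where `Φ` is explicit; the projection to
the orbit ring kills the characters outside `σ^⊥`. -/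
theorem orbitι_phi (hR : A.IsFace S R) :
    A.orbitι K hR ≫ A.phi K = Spec.map (CommRingCat.ofHom
      (MvPolynomial.aeval (R := K) (A.orbitCoordinate K S R)).toRingHom) := by
  have h1 : A.lawrenceFan.chartι K (A.fanCone hR) ≫ A.phi K = A.phiChart K (A.fanCone hR) :=
    colimit.ι_desc _ _
  have h2 : A.orbitι K hR ≫ A.phi K =
      Spec.map (CommRingCat.ofHom (orbitRingHom K (A.lawrenceCone S R)).toRingHom) ≫
        Spec.map (CommRingCat.ofHom (MvPolynomial.aeval (R := K) fun e =>
          AddMonoidAlgebra.single (⟨A.coordinateCharacter e, A.coordinateCharacter_mem S R e⟩ :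
            dualMonoid (A.lawrenceCone S R)) (1 : K)).toRingHom) :=
    (Category.assoc _ _ _).trans (congrArg (orbitToChart K (A.lawrenceCone S R) ≫ ·) h1)
  rw [h2, ← Spec.map_comp, ← CommRingCat.ofHom_comp]
  congr 2
  refine MvPolynomial.ringHom_ext (fun c => ?_) (fun e => ?_)
  · simp only [AlgHom.toRingHom_eq_coe, RingHom.comp_apply, RingHom.coe_coe, MvPolynomial.algHom_C,
      AlgHom.commutes]
  · simp [orbitRingHom, AddMonoidAlgebra.lift_single]
    rfl

/-- Pasting the two defining squares removes `𝔐_𝒜` and the glued variety: the intersection is the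
preimage of `L_{𝒜_0}` under a map of affine schemes. -/
theorem isPullback_orbitIntersectionι (hR : A.IsFace S R) :
    IsPullback (pullback.fst (A.hypertoricι K) (A.orbitι K hR) ≫
      pullback.snd (A.phi K) (A.linearSpaceι K)) (A.orbitIntersectionι K hR)
      (A.linearSpaceι K) (Spec.map (CommRingCat.ofHom
      (MvPolynomial.aeval (R := K) (A.orbitCoordinate K S R)).toRingHom)) := by
  rw [← orbitι_phi]
  exact (IsPullback.of_hasPullback (A.hypertoricι K) (A.orbitι K hR)).paste_horiz
    (IsPullback.of_hasPullback (A.phi K) (A.linearSpaceι K)).flip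

theorem exists_iso_orbitIntersection (hR : A.IsFace S R)
    {I : Ideal (AddMonoidAlgebra K (perpLattice (A.lawrenceCone S R)))}
    (hI : I = (A.linearIdeal K).map
      (MvPolynomial.aeval (R := K) (A.orbitCoordinate K S R)).toRingHom) :
    ∃ e : A.orbitIntersection K hR ≅ Spec (CommRingCat.of
        (AddMonoidAlgebra K (perpLattice (A.lawrenceCone S R)) ⧸ I)),
      e.hom ≫ Spec.map (CommRingCat.ofHom (Ideal.Quotient.mk I)) = A.orbitIntersectionι K hR := by
  have h1 := A.isPullback_orbitIntersectionι K hR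
  have h2 := isPullback_SpecMap_of_isPushout _ _ _ _ (CommRingCat.isPushout_quotient _ _ hI)
  exact ⟨h1.isoIsPullback _ _ h2, h1.isoIsPullback_hom_snd _ _ h2⟩

end Hypertoric.Arrangement

/-! ### The character lattice of an orbit -/

namespace Hypertoric

/-- Since `u ∈ σ^⊥` means `±u ∈ σ^∨`, the criterion on generators of the cone carries over from
`σ^∨`. -/
theorem mem_perpLattice_hull {L : Type u} [AddCommGroup L] {G : Set L} {u : Module.Dual ℤ L} :
    u ∈ perpLattice (PointedCone.hull ℝ ((fun g => (1 : ℝ) ⊗ₜ[ℤ] g) '' G)) ↔ ∀ g ∈ G, u g = 0 := by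
  have h : ∀ {σ : PointedCone ℝ (ℝ ⊗[ℤ] L)}, u ∈ perpLattice σ ↔
      u ∈ dualMonoid σ ∧ -u ∈ dualMonoid σ := fun {σ} => by
    simp only [mem_perpLattice, mem_dualMonoid, pairing_neg, ← forall_and]
    exact forall_congr' fun x => forall_congr' fun _ =>
      ⟨fun h => by simp [h], fun h => le_antisymm (by linarith [h.2]) h.1⟩
  rw [h, mem_dualMonoid_hull, mem_dualMonoid_hull, ← forall_and]
  refine forall_congr' fun g => ⟨fun h hg => ?_, fun h => ⟨fun hg => (h hg).ge, fun hg => ?_⟩⟩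
  · have := h.2 hg
    rw [LinearMap.neg_apply] at this
    exact le_antisymm (by linarith) (h.1 hg)
  · rw [LinearMap.neg_apply, h hg, neg_zero]

namespace Arrangement

variable {M E : Type u} [AddCommGroup M] (A : Arrangement M E)

/-- The sublattice of `M` on which the normal vectors `a_e`, `e ∈ T`, vanish. -/
def annihilator (T : Set E) : Submodule ℤ M := ⨅ e ∈ T, LinearMap.ker (A.normal e)

theorem mem_annihilator {T : Set E} {m : M} : m ∈ A.annihilator T ↔ ∀ e ∈ T, A.normal e m = 0 := by
  simp [annihilator]

theorem eq_zero_of_normal_apply_eq_zero [Module.Free ℤ M] [Module.Finite ℤ M] {m : M}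
    (h : ∀ e, A.normal e m = 0) : m = 0 := by
  refine (Module.forall_dual_apply_eq_zero_iff ℤ m).1 fun f => ?_
  have hf : f ∈ Submodule.span ℤ (Set.range A.normal) := A.spanning ▸ Submodule.mem_top
  have hle : Submodule.span ℤ (Set.range A.normal) ≤ LinearMap.ker (Module.Dual.eval ℤ M m) :=
    Submodule.span_le.2 (by rintro _ ⟨e, rfl⟩; exact h e)
  exact hle hf

variable {S : Set E} {R : Set (ℝ ⊗[ℤ] M)}

theorem posIndex_union_negIndex (hR : A.IsFace S R) : A.posIndex S R ∪ A.negIndex S R = S := by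
  obtain ⟨p, rfl⟩ := hR
  ext e
  rw [Set.mem_union, mem_posIndex, mem_negIndex, ← and_or_left]
  exact and_iff_left (le_total _ _)

variable [Fintype E]

theorem dual_lawrenceLattice_ext {u v : Module.Dual ℤ A.lawrenceLattice}
    (hp : ∀ e, u (A.rhoPos e) = v (A.rhoPos e)) (hn : ∀ e, u (A.rhoNeg e) = v (A.rhoNeg e)) :
    u = v := by
  classical
  refine Submodule.linearMap_qext _ (LinearMap.prod_ext ?_ ?_)
  · refine LinearMap.pi_ext' fun e => LinearMap.ext_ring ?_
    simpa [rhoPos] using hp e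
  · refine LinearMap.pi_ext' fun e => LinearMap.ext_ring ?_
    simpa [rhoNeg] using hn e

/-- The character of the Lawrence torus with values `q_e + ⟨m, a_e⟩` at `ρ_e^+` and `q_e` at
`ρ_e^-`. -/
noncomputable def character : M × (E → ℤ) →ₗ[ℤ] Module.Dual ℤ A.lawrenceLattice where
  toFun x := Submodule.liftQ _
    (LinearMap.coprod (Fintype.linearCombination ℤ fun e => x.2 e + A.normal e x.1)
      (Fintype.linearCombination ℤ x.2)) (by
    rintro _ ⟨c, hc, rfl⟩
    -- On `(c, -c)` the `q`-terms cancel, and what remains is `⟨m, ∑ c_e a_e⟩`, which is zero for a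
    -- relation `c`.
    have h := LinearMap.congr_fun (LinearMap.mem_ker.1 hc) x.1
    simp only [normalHom, Fintype.linearCombination_apply, LinearMap.sum_apply,
      LinearMap.smul_apply, LinearMap.zero_apply, smul_eq_mul] at h
    simp [antidiagonal, Fintype.linearCombination_apply, mul_add, Finset.sum_add_distrib, h])
  map_add' x y := by
    classical
    refine A.dual_lawrenceLattice_ext (fun e => ?_) (fun e => ?_) <;>
      simp [rhoPos, rhoNeg, Fintype.linearCombination_apply_single]
    abel
  map_smul' n x := by
    classical
    refine A.dual_lawrenceLattice_ext (fun e => ?_) (fun e => ?_) <;>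
      simp [rhoPos, rhoNeg, Fintype.linearCombination_apply_single, mul_add]

theorem character_rhoPos (x : M × (E → ℤ)) (e : E) :
    A.character x (A.rhoPos e) = x.2 e + A.normal e x.1 := by
  classical
  simp [character, rhoPos, Fintype.linearCombination_apply_single]

theorem character_rhoNeg (x : M × (E → ℤ)) (e : E) : A.character x (A.rhoNeg e) = x.2 e := by
  classical
  simp [character, rhoNeg, Fintype.linearCombination_apply_single]

open Classical in
theorem coordinateCharacter_rhoPos (e f : E) :
    A.coordinateCharacter e (A.rhoPos f) = if e = f then 1 else 0 := by
  change (Pi.single f 1 + 0 : E → ℤ) e = _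
  simp [Pi.single_apply]

open Classical in
theorem coordinateCharacter_rhoNeg (e f : E) :
    A.coordinateCharacter e (A.rhoNeg f) = if e = f then 1 else 0 := by
  change (0 + Pi.single f 1 : E → ℤ) e = _
  simp [Pi.single_apply]

theorem character_single [DecidableEq E] (e : E) :
    A.character (0, Pi.single e 1) = A.coordinateCharacter e := by
  refine A.dual_lawrenceLattice_ext (fun f => ?_) (fun f => ?_)
  · rw [character_rhoPos, coordinateCharacter_rhoPos]
    simp [Pi.single_apply, eq_comm]
  · rw [character_rhoNeg, coordinateCharacter_rhoNeg]
    simp [Pi.single_apply, eq_comm]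

theorem mem_perpLattice_lawrenceCone {u : Module.Dual ℤ A.lawrenceLattice} :
    u ∈ perpLattice (A.lawrenceCone S R) ↔
      (∀ e ∈ A.posIndex S R, u (A.rhoPos e) = 0) ∧ ∀ e ∈ A.negIndex S R, u (A.rhoNeg e) = 0 := by
  rw [lawrenceCone, mem_perpLattice_hull, rayGenerators]
  constructor
  · exact fun h => ⟨fun e he => h _ (Or.inl ⟨e, he, rfl⟩), fun e he => h _ (Or.inr ⟨e, he, rfl⟩)⟩
  · rintro ⟨h1, h2⟩ _ (⟨e, he, rfl⟩ | ⟨e, he, rfl⟩)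
    exacts [h1 e he, h2 e he]

/-- For `e ∈ S` at least one of `ρ_e^±` is a ray generator, and the character of `x_e` is `1` on it.
It is zero on `ρ_f^±` for `f ≠ e`, so the answer depends on `S` only. -/
theorem coordinateCharacter_mem_perpLattice_iff (hR : A.IsFace S R) {e : E} :
    A.coordinateCharacter e ∈ perpLattice (A.lawrenceCone S R) ↔ e ∉ S := by
  classical
  simp only [mem_perpLattice_lawrenceCone, coordinateCharacter_rhoPos, coordinateCharacter_rhoNeg]
  conv_rhs => rw [← A.posIndex_union_negIndex hR, Set.mem_union, not_or]
  refine and_congr ⟨fun h he => by simpa using h e he, fun h f hf => if_neg ?_⟩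
    ⟨fun h he => by simpa using h e he, fun h f hf => if_neg ?_⟩
  all_goals
    rintro rfl
    exact h hf

open Classical in
/-- The exponents `q_e` of the characters in `σ_{S,R}^⊥` which are given by `m ∈ M` and the
exponents for `e ∉ S`. -/
noncomputable def perpExponent (S : Set E) (R : Set (ℝ ⊗[ℤ] M)) :
    ({e // e ∉ S} → ℤ) × A.annihilator (A.zeroIndex S R) →ₗ[ℤ] M × (E → ℤ) where
  -- For `e ∈ S` the exponent is forced: vanishing at `ρ_e^-` gives `q_e = 0`, and vanishing at
  -- `ρ_e^+` gives `q_e = -⟨m, a_e⟩`. If both are required, then `⟨m, a_e⟩ = 0`, which is why `m`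
  -- lies in the annihilator.
  toFun x := (x.2, fun e => if h : e ∈ S then
    if e ∈ A.negIndex S R then 0 else -A.normal e x.2 else x.1 ⟨e, h⟩)
  map_add' x y := by
    ext e
    · rfl
    · dsimp; split_ifs <;> simp [add_comm]
  map_smul' n x := by
    ext e
    · rfl
    · dsimp; split_ifs <;> simp

theorem character_perpExponent_mem
    (x : ({e // e ∉ S} → ℤ) × A.annihilator (A.zeroIndex S R)) :
    A.character (A.perpExponent S R x) ∈ perpLattice (A.lawrenceCone S R) := by
  rw [mem_perpLattice_lawrenceCone]
  refine ⟨fun e he => ?_, fun e he => ?_⟩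
  · rw [character_rhoPos]
    by_cases hn : e ∈ A.negIndex S R
    · simp [perpExponent, he.1, hn, A.mem_annihilator.1 x.2.2 e ⟨he, hn⟩]
    · simp [perpExponent, he.1, hn]
  · rw [character_rhoNeg]
    simp [perpExponent, he.1, he]

variable [Module.Free ℤ M] [Module.Finite ℤ M]

/-- This is the splitting `M̃ ≅ M ⊕ ℤ^E`. The differences `u(ρ_e^+) - u(ρ_e^-)` define a functional
on `ℤ^E` that kills `Λ`, hence a functional on `N`, hence a point of `M`; the point is unique
because the `a_e` generate `N`. -/
theorem character_bijective : Function.Bijective A.character := by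
  constructor
  · rw [← LinearMap.ker_eq_bot, LinearMap.ker_eq_bot']
    intro x hx
    have h2 : x.2 = 0 := funext fun e => by
      rw [← A.character_rhoNeg, hx]; rfl
    refine Prod.ext (A.eq_zero_of_normal_apply_eq_zero fun e => ?_) h2
    have := A.character_rhoPos x e
    rw [hx, h2] at this
    simpa using this.symm
  · intro u
    obtain ⟨m, hm⟩ := A.exists_normal_apply_eq u
    refine ⟨(m, fun e => u (A.rhoNeg e)), A.dual_lawrenceLattice_ext (fun e => ?_) (fun e => ?_)⟩
    · rw [character_rhoPos, hm]; dsimp; ring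
    · rw [character_rhoNeg]

/-- The lattice `σ_{S,R}^⊥` is the direct sum of the lattice of exponents of the coordinates `x_e`,
`e ∉ S`, and a lattice isomorphic to the annihilator of the `a_e`, `R ⊆ H_e`. -/
noncomputable def perpLatticeEquiv (hR : A.IsFace S R) :
    (({e // e ∉ S} → ℤ) × A.annihilator (A.zeroIndex S R)) ≃ₗ[ℤ]
      perpLattice (A.lawrenceCone S R) :=
  LinearEquiv.ofBijective
    ((A.character ∘ₗ A.perpExponent S R).codRestrict _ A.character_perpExponent_mem) <| by
  constructor
  · rw [← LinearMap.ker_eq_bot, LinearMap.ker_codRestrict, LinearMap.ker_comp,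
      LinearMap.ker_eq_bot.2 A.character_bijective.1, Submodule.comap_bot, LinearMap.ker_eq_bot']
    intro x hx
    refine Prod.ext (funext fun e => ?_) (Subtype.ext congr($(hx).1))
    have : (A.perpExponent S R x).2 e.1 = 0 := by rw [hx]; rfl
    simpa [perpExponent, e.2] using this
  · rintro ⟨u, hu⟩
    obtain ⟨⟨m, q⟩, rfl⟩ := A.character_bijective.2 u
    rw [mem_perpLattice_lawrenceCone] at hu
    simp only [character_rhoPos, character_rhoNeg] at hu
    refine ⟨⟨fun e => q e, ⟨m, A.mem_annihilator.2 fun e he => ?_⟩⟩, Subtype.ext ?_⟩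
    · have h1 := hu.1 e he.1
      rwa [hu.2 e he.2, zero_add] at h1
    · refine congrArg A.character (Prod.ext rfl (funext fun e => ?_))
      by_cases he : e ∈ S
      · by_cases hn : e ∈ A.negIndex S R
        · simp [perpExponent, he, hn, hu.2 e hn]
        · have hp : e ∈ A.posIndex S R := by
            rw [← A.posIndex_union_negIndex hR] at he
            exact he.resolve_right hn
          have := hu.1 e hp
          simp only [perpExponent, he, hn, LinearMap.coe_mk, AddHom.coe_mk, dite_true, if_false]
          linarith
      · simp [perpExponent, he]

/-- A basis of `σ_{S,R}^⊥` which contains the exponents of the coordinates `x_e`, `e ∉ S`. -/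
noncomputable def perpLatticeBasis (hR : A.IsFace S R) :
    Module.Basis ({e // e ∉ S} ⊕ Fin (Module.finrank ℤ (A.annihilator (A.zeroIndex S R)))) ℤ
      (perpLattice (A.lawrenceCone S R)) := by
  classical
  exact ((Pi.basisFun ℤ {e // e ∉ S}).prod
    (Module.finBasis ℤ (A.annihilator (A.zeroIndex S R)))).map (A.perpLatticeEquiv hR)

theorem perpLatticeBasis_inl (hR : A.IsFace S R) (e : {e // e ∉ S}) :
    (A.perpLatticeBasis hR (Sum.inl e) : Module.Dual ℤ A.lawrenceLattice) =
      A.coordinateCharacter e := by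
  classical
  rw [← character_single]
  simp only [perpLatticeBasis, Module.Basis.map_apply, Module.Basis.prod_apply, Sum.elim_inl,
    Function.comp_apply, LinearMap.inl_apply, Pi.basisFun_apply]
  refine congrArg A.character (Prod.ext rfl (funext fun f => ?_))
  by_cases hf : f ∈ S
  · have : f ≠ e := fun h => e.2 (h ▸ hf)
    simp [perpExponent, hf, this]
  · simp [perpExponent, hf, Pi.single_apply, Subtype.ext_iff]

end Arrangement

end Hypertoric

/-! ### Ranks and relations over `K` -/

/-- A field of characteristic zero is flat over `ℤ`, so the span over `F` is the base change of the
span over `ℤ`. -/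
theorem Submodule.finrank_span_tmul_image {F N : Type*} [Field F] [CharZero F] [AddCommGroup N]
    [Module.Free ℤ N] [Module.Finite ℤ N] (s : Set N) :
    Module.finrank F (Submodule.span F ((fun v => (1 : F) ⊗ₜ[ℤ] v) '' s)) =
      Module.finrank ℤ (Submodule.span ℤ s) := by
  have h := Submodule.baseChange_span (R := ℤ) (A := F) s
  change _ = Submodule.span F ((fun v => (1 : F) ⊗ₜ[ℤ] v) '' s) at h
  have hinj : Function.Injective ((Submodule.span ℤ s).subtype.baseChange F) :=
    Module.Flat.lTensor_preserves_injective_linearMap (M := F) _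
      (Submodule.span ℤ s).injective_subtype
  rw [← h, Submodule.baseChange, LinearMap.finrank_range_of_inj hinj, Module.finrank_baseChange]

namespace Hypertoric.Arrangement

open Module

variable {M E : Type u} [AddCommGroup M] (A : Arrangement M E)

theorem mem_centralFlat {T : Set E} {x : ℝ ⊗[ℤ] M} :
    x ∈ A.centralFlat T ↔ ∀ e ∈ T, pairing (A.normal e) x = 0 := by
  simp [centralFlat, centralHyperplane]

/-- A point of `R` lies on all the hyperplanes containing `R`, so their intersection is a translate
of the central flat. -/
theorem codim_eq_rank {S : Set E} {R : Set (ℝ ⊗[ℤ] M)} (hR : A.IsFace S R) :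
    A.codim S R = A.rank (A.zeroIndex S R) := by
  have h : vectorSpan ℝ (⋂ e ∈ A.zeroIndex S R, A.hyperplane e) =
      A.centralFlat (A.zeroIndex S R) := by
    obtain ⟨p, hp⟩ := hR
    have hpR : p ∈ R := by rw [hp]; exact fun _ _ => rfl
    have hmem : ∀ x, x ∈ (⋂ e ∈ A.zeroIndex S R, A.hyperplane e) ↔
        ∀ e ∈ A.zeroIndex S R, A.affineForm e x = 0 := fun x => by simp [hyperplane]
    have hp0 : p ∈ ⋂ e ∈ A.zeroIndex S R, A.hyperplane e := (hmem p).2 fun e he =>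
      le_antisymm (he.1.2 hpR) (he.2.2 hpR)
    apply le_antisymm
    · rw [vectorSpan, Submodule.span_le]
      rintro _ ⟨x, hx, y, hy, rfl⟩
      refine A.mem_centralFlat.2 fun e he => ?_
      have h1 := (hmem x).1 hx e he
      have h2 := (hmem y).1 hy e he
      rw [affineForm] at h1 h2
      rw [show (fun x y : ℝ ⊗[ℤ] M => x -ᵥ y) x y = x - y from rfl, map_sub]
      linarith
    · intro x hx
      have h1 : x + p ∈ ⋂ e ∈ A.zeroIndex S R, A.hyperplane e := (hmem _).2 fun e he => by
        rw [affineForm, map_add, A.mem_centralFlat.1 hx e he, zero_add]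
        exact (hmem p).1 hp0 e he
      simpa using vsub_mem_vectorSpan ℝ h1 hp0
  rw [codim, rank, h]

theorem centralFlat_insert_eq_iff {S : Set E} {f : E} :
    A.centralFlat (insert f S) = A.centralFlat S ↔ A.centralFlat S ≤ A.centralHyperplane f := by
  rw [centralFlat, iInf_insert]
  exact inf_eq_right

variable (K : Type u) [Field K]

/-- The span of the vectors `1 ⊗ a_e`, `e ∈ T`, in `K ⊗ N`. -/
noncomputable def normalSpan (T : Set E) : Submodule K (K ⊗[ℤ] Dual ℤ M) :=
  Submodule.span K ((fun e => (1 : K) ⊗ₜ[ℤ] A.normal e) '' T)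

section Relations

variable [Fintype E]

theorem normalHom_surjective : Function.Surjective A.normalHom := by
  rw [← LinearMap.range_eq_top, normalHom, Fintype.range_linearCombination, A.spanning]

/-- Tensoring `Λ → ℤ^E → N → 0` with `K` is right exact, so in any characteristic every relation
over `K` is a combination of integral ones. -/
theorem mem_span_relations {c : E → K} (hc : ∑ e, c e • ((1 : K) ⊗ₜ[ℤ] A.normal e) = 0) :
    c ∈ Submodule.span K ((fun (l : E → ℤ) (e : E) => (l e : K)) '' (A.relations : Set (E → ℤ))) := by
  classical
  let e := TensorProduct.piScalarRight ℤ ℤ K E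
  have hex := lTensor_exact K (LinearMap.exact_subtype_ker_map A.normalHom) A.normalHom_surjective
  have h1 : ∀ c : E → K, A.normalHom.lTensor K (e.symm c) =
      ∑ e, c e • ((1 : K) ⊗ₜ[ℤ] A.normal e) := fun c => by
    conv_lhs => rw [← Finset.univ_sum_single c, map_sum, map_sum]
    refine Finset.sum_congr rfl fun i _ => ?_
    rw [TensorProduct.piScalarRight_symm_single, LinearMap.lTensor_tmul, TensorProduct.smul_tmul',
      normalHom, Fintype.linearCombination_apply_single, smul_eq_mul, mul_one, one_smul]
  obtain ⟨t, ht⟩ := (hex _).1 ((h1 c).trans hc)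
  have h2 : c = e ((LinearMap.ker A.normalHom).subtype.lTensor K t) := by
    rw [ht, LinearEquiv.apply_symm_apply]
  rw [h2]
  clear h2 ht hc
  induction t with
  | zero => simp
  | add x y hx hy => rw [map_add, map_add]; exact add_mem hx hy
  | tmul k l =>
    have h3 : e ((LinearMap.ker A.normalHom).subtype.lTensor K (k ⊗ₜ l)) =
        k • fun e : E => (l.1 e : K) := by
      ext i
      simp [e, mul_comm]
    rw [h3]
    exact Submodule.smul_mem _ _ (Submodule.subset_span ⟨l, l.2, rfl⟩)

open Classical in
/-- The homomorphism `K^{E ∖ S} → (K ⊗ N) / ⟨a_e, e ∈ S⟩`, `δ_e ↦ 1 ⊗ a_e`. -/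
noncomputable def contraction (S : Set E) :
    ({e // e ∉ S} → K) →ₗ[K] (K ⊗[ℤ] Dual ℤ M) ⧸ A.normalSpan K S :=
  Fintype.linearCombination K fun e => (A.normalSpan K S).mkQ ((1 : K) ⊗ₜ[ℤ] A.normal e)

theorem sum_eq_sum_subtype_add {X : Type*} [AddCommMonoid X] (S : Set E) [DecidablePred (· ∈ S)]
    (g : E → X) : ∑ e, g e = ∑ e ∈ Finset.univ.filter (· ∈ S), g e + ∑ e : {e // e ∉ S}, g e := by
  rw [← Finset.sum_filter_add_sum_filter_not Finset.univ (· ∈ S) g]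
  congr 1
  exact Finset.sum_subtype _ (by simp) g

theorem mkQ_sum_tmul (S : Set E) (c : E → K) :
    (A.normalSpan K S).mkQ (∑ e, c e • ((1 : K) ⊗ₜ[ℤ] A.normal e)) =
      A.contraction K S fun e => c e := by
  classical
  rw [sum_eq_sum_subtype_add S, map_add, contraction, Fintype.linearCombination_apply, map_sum,
    map_sum]
  simp only [map_smul]
  rw [add_eq_right]
  refine Finset.sum_eq_zero fun e he => ?_
  rw [Finset.mem_filter] at he
  rw [Submodule.mkQ_apply, (Submodule.Quotient.mk_eq_zero _).2, smul_zero]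
  exact Submodule.subset_span ⟨e, he.2, rfl⟩

theorem sum_relation_tmul {l : E → ℤ} (hl : l ∈ A.relations) :
    ∑ e, (l e : K) • ((1 : K) ⊗ₜ[ℤ] A.normal e) = 0 := by
  have h := LinearMap.mem_ker.1 hl
  rw [normalHom, Fintype.linearCombination_apply] at h
  have h' := congrArg (fun x => (1 : K) ⊗ₜ[ℤ] x) h
  simpa [TensorProduct.tmul_sum, Int.cast_smul_eq_zsmul] using h'

/-- A vector on `E ∖ S` extends to a relation over `K` exactly when its combination of the `a_e`
lies in the span of those with `e ∈ S`; `mem_span_relations` then passes to integral relations. -/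
theorem span_restrict_relations (S : Set E) :
    Submodule.span K ((fun (l : E → ℤ) (e : {e // e ∉ S}) => (l e : K)) ''
      (A.relations : Set (E → ℤ))) = LinearMap.ker (A.contraction K S) := by
  classical
  apply le_antisymm
  · rw [Submodule.span_le]
    rintro _ ⟨l, hl, rfl⟩
    have := A.mkQ_sum_tmul K S fun e => (l e : K)
    rw [A.sum_relation_tmul K hl, map_zero] at this
    exact this.symm
  · intro c hc
    have h1 : ∑ e : {e // e ∉ S}, c e • ((1 : K) ⊗ₜ[ℤ] A.normal e) ∈ A.normalSpan K S := by
      rw [← Submodule.Quotient.mk_eq_zero, ← Submodule.mkQ_apply, map_sum]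
      simpa [contraction, Fintype.linearCombination_apply] using hc
    have himg : (fun e => (1 : K) ⊗ₜ[ℤ] A.normal e) '' S = Set.range fun e : S =>
        (1 : K) ⊗ₜ[ℤ] A.normal e := by
      ext x; simp
    rw [normalSpan, himg, Submodule.mem_span_range_iff_exists_fun] at h1
    obtain ⟨g, hg⟩ := h1
    -- The coefficients on `S` are chosen to cancel the combination over `E ∖ S`.
    let c' : E → K := fun e => if h : e ∈ S then -g ⟨e, h⟩ else c ⟨e, h⟩
    have hc' : ∑ e, c' e • ((1 : K) ⊗ₜ[ℤ] A.normal e) = 0 := by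
      rw [sum_eq_sum_subtype_add S, Finset.sum_subtype (p := (· ∈ S)) _ (by simp)]
      have h2 : ∀ e : {e // e ∉ S}, c' e = c e := fun e => by simp [c', e.2]
      have h3 : ∀ e : S, c' e = -g e := fun e => by simp [c', e.2]
      simp only [h2, ← hg]
      rw [← Finset.sum_add_distrib]
      refine Finset.sum_eq_zero fun e _ => ?_
      rw [h3 e, neg_smul, neg_add_cancel]
    have h4 := Submodule.mem_map_of_mem (f := LinearMap.funLeft K K
      (Subtype.val : {e // e ∉ S} → E)) (A.mem_span_relations K hc')
    rw [Submodule.map_span, Set.image_image] at h4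
    have h5 : LinearMap.funLeft K K (Subtype.val : {e // e ∉ S} → E) c' = c := by
      funext e
      simp [LinearMap.funLeft_apply, c', e.2]
    rwa [h5] at h4

theorem contraction_surjective (S : Set E) : Function.Surjective (A.contraction K S) := by
  classical
  intro x
  obtain ⟨x, rfl⟩ := (A.normalSpan K S).mkQ_surjective x
  suffices h : ∃ c : E → K, ∑ e, c e • ((1 : K) ⊗ₜ[ℤ] A.normal e) = x by
    obtain ⟨c, rfl⟩ := h
    exact ⟨_, (A.mkQ_sum_tmul K S c).symm⟩
  rw [← Submodule.mem_span_range_iff_exists_fun]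
  have h := Submodule.baseChange_span (R := ℤ) (A := K) (Set.range A.normal)
  rw [A.spanning, Submodule.baseChange_top, ← Set.range_comp] at h
  exact h ▸ Submodule.mem_top

theorem single_mem_ker_contraction_iff {S : Set E} [DecidableEq {e // e ∉ S}] {f : {e // e ∉ S}} :
    Pi.single f 1 ∈ LinearMap.ker (A.contraction K S) ↔
      (1 : K) ⊗ₜ[ℤ] A.normal f ∈ A.normalSpan K S := by
  rw [LinearMap.mem_ker, contraction, Fintype.linearCombination_apply_single, one_smul,
    Submodule.mkQ_apply, Submodule.Quotient.mk_eq_zero]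

end Relations

variable [Module.Free ℤ M] [Module.Finite ℤ M]

/-- By flatness of `ℝ` over `ℤ`, the central flat is the real extension of the integral annihilator,
so both have the same rank. -/
theorem finrank_annihilator_add_rank [Finite E] (T : Set E) :
    finrank ℤ (A.annihilator T) + A.rank T = finrank ℤ M := by
  classical
  have := Fintype.ofFinite T
  let α : M →ₗ[ℤ] (T → ℤ) := LinearMap.pi fun e => A.normal e
  have hα : A.annihilator T = LinearMap.ker α := by
    ext m
    simp [α, mem_annihilator, funext_iff]
  have hflat : A.centralFlat T = LinearMap.ker (TensorProduct.AlgebraTensorModule.lTensor ℝ ℝ α) := by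
    ext x
    rw [mem_centralFlat, LinearMap.mem_ker,
      ← (TensorProduct.piScalarRight ℤ ℝ ℝ T).map_eq_zero_iff, funext_iff, Subtype.forall]
    refine forall₂_congr fun e he => Eq.congr_left ?_
    induction x with
    | zero => simp
    | add x y hx hy => simp only [map_add, hx, hy, Pi.add_apply]
    | tmul t m => simp [pairing_tmul, α]
  rw [Module.Flat.ker_lTensor_eq] at hflat
  have hinj : Function.Injective
      (TensorProduct.AlgebraTensorModule.lTensor ℝ ℝ (LinearMap.ker α).subtype) :=
    Module.Flat.lTensor_preserves_injective_linearMap (M := ℝ) _ (LinearMap.ker α).injective_subtype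
  have h1 : finrank ℝ (A.centralFlat T) = finrank ℤ (A.annihilator T) := by
    rw [hflat, LinearMap.finrank_range_of_inj hinj, Module.finrank_baseChange, hα]
  rw [← h1, rank, add_comm, Submodule.finrank_quotient_add_finrank, Module.finrank_baseChange]

/-- Over `ℝ` the central flat is the coannihilator of the span of the `a_e`, so its codimension is
the dimension of that span, which equals the rank over `ℤ`. -/
theorem rank_eq_finrank_span (T : Set E) :
    A.rank T = finrank ℤ (Submodule.span ℤ (A.normal '' T)) := by
  have ibc := TensorProduct.isBaseChange ℤ M ℝ
  let e := ibc.toDualBaseChange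
  have he : ∀ f : Dual ℤ M, e (1 ⊗ₜ f) = pairing f := fun f => by
    refine ibc.algHom_ext _ _ fun m => ?_
    rw [IsBaseChange.toDualBaseChange_tmul]
    simp [pairing_tmul]
  have h1 : Submodule.span ℝ ((fun e => pairing (A.normal e)) '' T) =
      (Submodule.span ℝ ((fun v => (1 : ℝ) ⊗ₜ[ℤ] v) '' (A.normal '' T))).map e.toLinearMap := by
    rw [Submodule.map_span, Set.image_image, Set.image_image]
    simp only [LinearEquiv.coe_coe, he]
  have h2 : A.centralFlat T =
      (Submodule.span ℝ ((fun e => pairing (A.normal e)) '' T)).dualCoannihilator := by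
    apply SetLike.coe_injective
    rw [Submodule.coe_dualCoannihilator_span]
    ext x
    simp [mem_centralFlat]
  have h3 := Subspace.finrank_add_finrank_dualCoannihilator_eq
    (Submodule.span ℝ ((fun e => pairing (A.normal e)) '' T))
  have h4 := (A.centralFlat T).finrank_quotient_add_finrank
  rw [← h2, h1, LinearEquiv.finrank_map_eq, Submodule.finrank_span_tmul_image] at h3
  rw [rank]
  omega

theorem rankOver_eq_rank
    (hK : CharZero K ∨ ∀ T : Set E, A.rankOver K T = A.rank T) (T : Set E) :
    A.rankOver K T = A.rank T := by
  obtain hK | hK := hK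
  · rw [rank_eq_finrank_span, ← Submodule.finrank_span_tmul_image (F := K), rankOver,
      Set.image_image]
  · exact hK T

/-- Both sides say that adding `f` to `S` does not raise the rank, measured over `ℝ` and over `K`.
The equality of the two ranks is needed for `S` and for `insert f S`. -/
theorem centralFlat_le_iff (hK : ∀ T : Set E, A.rankOver K T = A.rank T) {S : Set E} {f : E} :
    A.centralFlat S ≤ A.centralHyperplane f ↔ (1 : K) ⊗ₜ[ℤ] A.normal f ∈ A.normalSpan K S := by
  have h1 := (A.centralFlat S).finrank_quotient_add_finrank
  have h2 := (A.centralFlat (insert f S)).finrank_quotient_add_finrank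
  have h3 := hK S
  have h4 := hK (insert f S)
  have hle : A.normalSpan K S ≤ A.normalSpan K (insert f S) :=
    Submodule.span_mono (Set.image_mono (Set.subset_insert f S))
  have hle' : A.centralFlat (insert f S) ≤ A.centralFlat S :=
    biInf_mono fun _ h => Set.mem_insert_of_mem f h
  rw [rank] at h3 h4
  have h5 : finrank K (A.normalSpan K S) = A.rankOver K S := rfl
  have h6 : finrank K (A.normalSpan K (insert f S)) = A.rankOver K (insert f S) := rfl
  rw [← centralFlat_insert_eq_iff]
  constructor
  · intro h
    rw [h] at h4
    rw [Submodule.eq_of_le_of_finrank_eq hle (by omega)]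
    exact Submodule.subset_span ⟨f, Set.mem_insert f S, rfl⟩
  · intro h
    have h7 : A.normalSpan K (insert f S) = A.normalSpan K S := by
      refine le_antisymm (Submodule.span_le.2 ?_) hle
      rintro _ ⟨e, rfl | he, rfl⟩
      exacts [h, Submodule.subset_span ⟨e, he, rfl⟩]
    rw [h7] at h6
    exact Submodule.eq_of_le_of_finrank_eq hle' (by omega)

theorem isFlat_iff (hK : ∀ T : Set E, A.rankOver K T = A.rank T) {S : Set E} :
    A.IsFlat S ↔ ∀ f : {e // e ∉ S}, (1 : K) ⊗ₜ[ℤ] A.normal f ∉ A.normalSpan K S := by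
  simp only [IsFlat, ← A.centralFlat_le_iff K hK, Subtype.forall, Set.ext_iff]
  refine forall_congr' fun f => ⟨fun h h1 h2 => h1 (h.2 h2), fun h => ⟨fun h1 => ?_, fun h1 => ?_⟩⟩
  · exact biInf_le A.centralHyperplane h1
  · by_contra h2
    exact h h2 h1

/-- Rank-nullity: the target of the surjective contraction has dimension `d - rk_K S`. -/
theorem finrank_ker_contraction [Fintype E] (S : Set E) [Fintype {e // e ∉ S}] :
    finrank K (LinearMap.ker (A.contraction K S)) + finrank ℤ M =
      Fintype.card {e // e ∉ S} + A.rankOver K S := by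
  have h1 := LinearMap.finrank_range_add_finrank_ker (A.contraction K S)
  rw [LinearMap.range_eq_top.2 (A.contraction_surjective K S), finrank_top,
    finrank_fintype_fun_eq_card] at h1
  have h2 := (A.normalSpan K S).finrank_quotient_add_finrank
  rw [Module.finrank_baseChange, ← (Free.chooseBasis ℤ M).toDualEquiv.finrank_eq] at h2
  have h3 : finrank K (A.normalSpan K S) = A.rankOver K S := rfl
  omega

end Hypertoric.Arrangement

/-! ### The linear forms on an orbit -/

namespace Hypertoric.Arrangement

open Module

variable {M E : Type u} [AddCommGroup M] [Fintype E] (A : Arrangement M E)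
  (K : Type u) [Field K]
  {S : Set E} {R : Set (ℝ ⊗[ℤ] M)}

/-- The coefficient vectors of the restrictions of the linear forms `∑ c_e x_e`, `c ∈ Λ`, to the
orbit `O(σ_{S,R})`. -/
def orbitForms (S : Set E) (κ : Type*) : Set ({e // e ∉ S} ⊕ κ → K) :=
  (fun (l : E → ℤ) => Sum.elim (fun e : {e // e ∉ S} => (l e : K)) 0) '' (A.relations : Set (E → ℤ))

/-- Extension by zero of coefficient vectors. -/
def zeroExtend (α κ : Type*) : (α → K) →ₗ[K] (α ⊕ κ → K) where
  toFun v := Sum.elim v 0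
  map_add' v w := by ext (_ | _) <;> simp
  map_smul' c v := by ext (_ | _) <;> simp

theorem span_orbitForms (S : Set E) (κ : Type*) :
    Submodule.span K (A.orbitForms K S κ) =
      (LinearMap.ker (A.contraction K S)).map (zeroExtend K {e // e ∉ S} κ) := by
  rw [← span_restrict_relations, Submodule.map_span, Set.image_image]
  rfl

theorem finrank_span_orbitForms (S : Set E) (κ : Type*) :
    finrank K (Submodule.span K (A.orbitForms K S κ)) =
      finrank K (LinearMap.ker (A.contraction K S)) := by
  rw [span_orbitForms]
  refine (Submodule.equivMapOfInjective _ (fun v w h => ?_) _).finrank_eq.symm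
  exact funext fun e => congrFun h (Sum.inl e)

/-- By `span_orbitForms` the question is whether `δ_f` is killed by the contraction, that is,
whether `a_f` is zero modulo the `a_e`, `e ∈ S`. -/
theorem single_inl_mem_span_orbitForms_iff {κ : Type*} [DecidableEq ({e // e ∉ S} ⊕ κ)]
    {f : {e // e ∉ S}} :
    Pi.single (Sum.inl f) 1 ∈ Submodule.span K (A.orbitForms K S κ) ↔
      (1 : K) ⊗ₜ[ℤ] A.normal f ∈ A.normalSpan K S := by
  classical
  rw [span_orbitForms, ← single_mem_ker_contraction_iff]
  constructor
  · rintro ⟨v, hv, h⟩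
    have h1 : v = Pi.single f 1 := funext fun e => by
      have := congrFun h (Sum.inl e)
      simp only [zeroExtend, LinearMap.coe_mk, AddHom.coe_mk, Sum.elim_inl] at this
      rw [this]
      simp [Pi.single_apply]
    exact h1 ▸ hv
  · intro h
    refine ⟨_, h, ?_⟩
    ext (e | k) <;> simp [zeroExtend, Pi.single_apply]

/-- The characters from the annihilator do not occur in the forms, so only the coordinates `x_f`, `f
∉ S`, can obstruct nonemptiness. -/
theorem single_inr_notMem_span_orbitForms {κ : Type*} [DecidableEq ({e // e ∉ S} ⊕ κ)] (k : κ) :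
    Pi.single (Sum.inr k) 1 ∉ Submodule.span K (A.orbitForms K S κ) := by
  rw [span_orbitForms]
  rintro ⟨v, -, h⟩
  simpa [zeroExtend] using congrFun h (Sum.inr k)

variable [Module.Free ℤ M] [Module.Finite ℤ M]

/-- In `∑ c_e x_e` the terms with `e ∈ S` restrict to zero and the others are multiples of basis
characters, so the pulled back equations are linear in the basis. -/
theorem linearIdeal_perpLatticeBasis [Fintype {e // e ∉ S}] (hR : A.IsFace S R) :
    (A.perpLatticeBasis hR).linearIdeal (A.orbitForms K S _) =
      (A.linearIdeal K).map (MvPolynomial.aeval (R := K) (A.orbitCoordinate K S R)).toRingHom := by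
  classical
  rw [linearIdeal, Ideal.map_span, Basis.linearIdeal, orbitForms, Set.image_image, Set.image_image]
  congr 1
  refine Set.image_congr fun l _ => ?_
  have h1 : ∀ e ∈ S, A.orbitCoordinate K S R e = 0 := fun e he =>
    dif_neg fun h => (A.coordinateCharacter_mem_perpLattice_iff hR).1 h he
  have h2 : ∀ e : {e // e ∉ S}, A.orbitCoordinate K S R e =
      AddMonoidAlgebra.single (A.perpLatticeBasis hR (Sum.inl e)) 1 := fun e => by
    rw [orbitCoordinate, dif_pos ((A.coordinateCharacter_mem_perpLattice_iff hR).2 e.2)]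
    congr 1
    exact Subtype.ext (A.perpLatticeBasis_inl hR e).symm
  have h3 : ∀ (c : K) e, (MvPolynomial.aeval (R := K) (A.orbitCoordinate K S R)).toRingHom
      (MvPolynomial.C c * MvPolynomial.X e) = c • A.orbitCoordinate K S R e := fun c e => by
    simp [Algebra.smul_def]
  rw [Fintype.sum_sum_type, map_sum]
  simp only [h3]
  have h4 : ∑ e with e ∈ S, (l e : K) • A.orbitCoordinate K S R e = 0 :=
    Finset.sum_eq_zero fun e he => by rw [h1 e (Finset.mem_filter.1 he).2, smul_zero]
  rw [sum_eq_sum_subtype_add S (fun e => (l e : K) • A.orbitCoordinate K S R e), h4, zero_add]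
  simp only [Sum.elim_inl, Sum.elim_inr, Pi.zero_apply, AddMonoidAlgebra.single_zero,
      Finset.sum_const_zero, add_zero, h2, AddMonoidAlgebra.smul_single, smul_eq_mul, mul_one]
  exact Finset.sum_congr (by ext; simp) fun _ _ => rfl

end Hypertoric.Arrangement

/-! ### Assembly of the proposition -/

theorem proposition5p1 {K : Type u} [Field K] {M E : Type u} [AddCommGroup M] [Module.Free ℤ M]
    [Module.Finite ℤ M] [Fintype E] (A : Hypertoric.Arrangement M E)
    (hK : CharZero K ∨ ∀ T : Set E, A.rankOver K T = A.rank T)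
    (S : Set E) (R : Set (ℝ ⊗[ℤ] M)) (hR : A.IsFace S R) :
    (Nonempty (A.orbitIntersection K hR) ↔ A.IsFlat S) ∧
    (A.IsFlat S →
      Hypertoric.IsLinearSubvariety (A.orbitIntersectionι K hR) ∧
      IsReduced (A.orbitIntersection K hR) ∧
      IrreducibleSpace (A.orbitIntersection K hR) ∧
      topologicalKrullDim (A.orbitIntersection K hR) + A.rank S + A.codim S R =
        2 * Module.finrank ℤ M) := by
  classical
  have hrank := A.rankOver_eq_rank K hK
  set b := A.perpLatticeBasis hR
  set s := A.orbitForms K S (Fin (Module.finrank ℤ (A.annihilator (A.zeroIndex S R)))) with hs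
  have hI := A.linearIdeal_perpLatticeBasis K hR
  obtain ⟨e, he⟩ := A.exists_iso_orbitIntersection K hR hI
  let h := e.hom.homeomorph
  have hflat : A.IsFlat S → ∀ i, Pi.single i 1 ∉ Submodule.span K s := fun hS => by
    rintro (f | k)
    · rw [hs, A.single_inl_mem_span_orbitForms_iff]
      exact (A.isFlat_iff K hrank).1 hS f
    · exact A.single_inr_notMem_span_orbitForms K k
  refine ⟨⟨fun hne => ?_, fun hS => ?_⟩, fun hS => ⟨?_, ?_, ?_, ?_⟩⟩
  · rw [A.isFlat_iff K hrank]
    intro f hf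
    have := b.quotient_linearForms_subsingleton
      (A.single_inl_mem_span_orbitForms_iff (κ := Fin _) K |>.2 hf)
    obtain ⟨x⟩ := hne
    exact (PrimeSpectrum.isEmpty_iff_subsingleton.2 this).false (h x)
  · have := (b.quotient_linearForms (hflat hS)).1
    -- The coordinate ring is a domain, so its zero ideal is a point.
    exact ⟨h.symm (⊥ : PrimeSpectrum _)⟩
  · let σ := Fintype.equivFin
      ({e // e ∉ S} ⊕ Fin (Module.finrank ℤ (A.annihilator (A.zeroIndex S R))))
    refine ⟨_, b.reindex σ, (fun c => c ∘ σ.symm) '' s, ?_⟩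
    refine A.exists_iso_orbitIntersection K hR (Eq.trans ?_ hI)
    rw [Module.Basis.linearIdeal, Set.image_image]
    congr 1
    refine Set.image_congr fun c _ => ?_
    simpa using Fintype.sum_equiv σ.symm
      (fun j => AddMonoidAlgebra.single (b (σ.symm j)) (c (σ.symm j)))
      (fun i => AddMonoidAlgebra.single (b i) (c i)) fun _ => rfl
  · have := (b.quotient_linearForms (hflat hS)).1
    exact isReduced_of_isOpenImmersion e.hom
  · have := (b.quotient_linearForms (hflat hS)).1
    have : IrreducibleSpace (PrimeSpectrum
      (AddMonoidAlgebra K (Hypertoric.perpLattice (A.lawrenceCone S R)) ⧸ b.linearIdeal s)) :=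
      inferInstance
    exact h.symm.surjective.irreducibleSpace h.symm.continuous
  · have h1 := (b.quotient_linearForms (hflat hS)).2
    have h2 := A.finrank_ker_contraction K S
    have h3 := A.finrank_annihilator_add_rank (A.zeroIndex S R)
    rw [← A.codim_eq_rank hR] at h3
    rw [hrank] at h2
    have h4 : topologicalKrullDim (A.orbitIntersection K hR) = ringKrullDim
        (AddMonoidAlgebra K (Hypertoric.perpLattice (A.lawrenceCone S R)) ⧸ b.linearIdeal s) :=
      h.isHomeomorph.topologicalKrullDim_eq.trans
        (PrimeSpectrum.topologicalKrullDim_eq_ringKrullDim _)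
    have h5 := (Submodule.span K s).finrank_quotient_add_finrank
    rw [A.finrank_span_orbitForms, Module.finrank_fintype_fun_eq_card, Fintype.card_sum,
      Fintype.card_fin] at h5
    -- With `h2`, `h3` and `h5` what remains is the count of variables minus independent forms, in
    -- natural numbers and without subtraction.
    rw [h4, h1]
    norm_cast
    omega
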